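/- Let $S$ be the set of $(a,b)\in\mathbb R^2$ with $b>0$, $a\sqrt2>b+2$, $b<\frac{a^2-1}{2a+1}$ and $2a+b<4$. For $(a,b)\in S$ let $L=L_{a,b}(x,y)=(1+y-a|x|,\,bx)$ be the Lozi map, $X=\bigl(\frac1{1+a-b},\frac b{1+a-b}\bigr)$ its fixed point in the first quadrant, $Z=\bigl(\frac{2+a+\sqrt{a^2+4b}}{2(1+a-b)},0\bigr)$, and $R=\{P: L^{-n}(P)\to X \text{ as } n\to\infty\}$ the unstable manifold of $X$. $R$ is the image of the real line under a continuous injective map; order $R$ accordingly, so that the half of $R$ leaving $X$ to the right consists of the points larger than $X$. A point $G\in R$ is a *gluing point* if it lies on the $y$-axis and $L^{-k}(G)$ does not for all $k\ge1$. *Turning points* are the images $L(G)$ of gluing points, *postturning points* the images $L^j(T)$, $j\ge1$, of turning points $T$; together these are the *basic points*. An *itinerary* of $P\in R$ is a sequence $(p_n)_{n\in\mathbb Z}\in\{-1,+1\}^{\mathbb Z}$ such that the $x$-coordinate of $L^n(P)$ is $\le0$ if $p_n=-1$ and $\ge0$ if $p_n=+1$, and such that, if $L^k(P)$ and $L^l(P)$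 are on the $y$-axis for some $k<l$, then $p_l$ is the sign of the $x$-coordinate of $L^l(Q)$ for all $Q\in R\setminus\{P\}$ sufficiently close to $P$ along $R$. The *kneading set* is the set of all itineraries of all turning points. **Theorem.** (i) For every $(a,b)\in S$ there is exactly one enumeration $(E_i)_{i\in\mathbb Z}$ of all basic points that is strictly increasing along $R$ and has $E_0=L^{-1}(Z)$. Let the *folding pattern* be the sequence indexed by $i\in\mathbb Z$ whose $i$-th symbol is $G$ if $E_i$ is a gluing point and $T$ otherwise (with a symbol $X$ inserted between the positions $0$ and $1$). Let the *folding tree* be the directed graph on $\mathbb Z$ with an arrow from $i$ to $j$ if and only if $L([E_i,E_{i+1}])\supset[E_j,E_{j+1}]$, where $[E_i,E_{i+1}]$ is the arc of $R$ between $E_i$ and $E_{i+1}$. Vertex $0$ is at level $0$, and the end of a path of $n\ge0$ arrows starting at vertex $-1$ is at level $n+1$; each level is ordered from left to right by increasing $|i|$. (ii) The kneading set, the folding pattern and the folding tree determine each other. That is, for all $(a,b),(a',b')\in S$ the following are equivalent: $L_{a,b}$ and $L_{a',b'}$ have the same kneading set; they have the same folding pattern; they have the same folding tree (as a graph on $\mathbb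 Z$); their folding trees without the vertex numbers are the same, that is, there is a graph isomorphism between them preserving the left-to-right order of the vertices of each level. -/

import Mathlib

open Filter Topology

namespace Lozi

/-! ## The Lozi map and the parameter set -/

/-- The Lozi map `L_{a,b}(x, y) = (1 + y - a|x|, b x)`. -/
def L (a b : ℝ) (P : ℝ × ℝ) : ℝ × ℝ := (1 + P.2 - a * |P.1|, b * P.1)

/-- The inverse of the Lozi map (for `b ≠ 0`, see `Linv_L` and `L_Linv`). -/
noncomputable def Linv (a b : ℝ) (P : ℝ × ℝ) : ℝ × ℝ := (P.2 / b, P.1 - 1 + a * |P.2 / b|)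

theorem Linv_L {a b : ℝ} (hb : b ≠ 0) (P : ℝ × ℝ) : Linv a b (L a b P) = P := by
  obtain ⟨x, y⟩ := P
  simp only [L, Linv, mul_div_cancel_left₀ _ hb, Prod.mk.injEq, true_and]
  ring

theorem L_Linv {a b : ℝ} (hb : b ≠ 0) (P : ℝ × ℝ) : L a b (Linv a b P) = P := by
  obtain ⟨x, y⟩ := P
  simp only [L, Linv, mul_div_cancel₀ _ hb, Prod.mk.injEq, and_true]
  ring

/-- The iterates `L^n`, `n ∈ ℤ`. -/
noncomputable def iter (a b : ℝ) : ℤ → ℝ × ℝ → ℝ × ℝ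
  | Int.ofNat n => (L a b)^[n]
  | Int.negSucc n => (Linv a b)^[n + 1]

/-- The set `S` of parameters `(a, b)`. -/
def S : Set (ℝ × ℝ) :=
  {p | 0 < p.2 ∧ p.2 + 2 < p.1 * √2 ∧ p.2 < (p.1 ^ 2 - 1) / (2 * p.1 + 1) ∧ 2 * p.1 + p.2 < 4}

/-! ## The unstable manifold of the fixed point `X` -/

/-- The fixed point `X` in the first quadrant. -/
noncomputable def X (a b : ℝ) : ℝ × ℝ := (1 / (1 + a - b), b / (1 + a - b))

/-- The point `Z`, where the right half of the unstable manifold of `X` first meets the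
horizontal axis. -/
noncomputable def Z (a b : ℝ) : ℝ × ℝ := ((2 + a + √(a ^ 2 + 4 * b)) / (2 * (1 + a - b)), 0)

/-- The unstable manifold `R = W^u_X`. -/
def R (a b : ℝ) : Set (ℝ × ℝ) :=
  {P | Tendsto (fun n : ℕ => (Linv a b)^[n] P) atTop (𝓝 (X a b))}

/-- The unstable (negative) eigenvalue of the derivative of `L` at `X`. -/
noncomputable def eig (a b : ℝ) : ℝ := -(a + √(a ^ 2 + 4 * b)) / 2

/-- The point `X + s v`, where `v = (1, b / eig)` is the unstable eigenvector at `X`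
pointing to the right. -/
noncomputable def localPt (a b s : ℝ) : ℝ × ℝ :=
  (1 / (1 + a - b) + s, b / (1 + a - b) + s * (b / eig a b))

/-- The parametrization of `R` by the real line that sends `0` to `X`, is directed to the right
at `X`, and conjugates `L` on `R` with multiplication by the unstable eigenvalue. The sequence
whose limit is taken is eventually constant. See `param_zero`, `continuous_param`,
`param_injective`, `range_param`, `L_param` and `param_eq_localPt`. -/
noncomputable def param (a b t : ℝ) : ℝ × ℝ :=
  limUnder atTop (fun n : ℕ => (L a b)^[n] (localPt a b (t / eig a b ^ n)))

section ParamFacts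

variable {a b : ℝ}

theorem S_bounds (h : (a, b) ∈ S) : 0 < b ∧ b < 1 ∧ 1 < a ∧ 0 < 1 + a - b := by
  obtain ⟨h1, h2, h3, h4⟩ := h
  simp only at h1 h2 h3 h4
  have hs : √2 < 3 / 2 := by
    rw [Real.sqrt_lt' (by norm_num)]; norm_num
  have hs0 : 0 < √2 := by positivity
  have ha : 0 < a := by
    by_contra hn
    nlinarith
  have h5 : b + 2 < a * (3 / 2) := by nlinarith
  refine ⟨h1, by linarith, by linarith, by linarith⟩

theorem eig_sq (h : (a, b) ∈ S) : eig a b ^ 2 = b - a * eig a b := by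
  obtain ⟨h1, -⟩ := S_bounds h
  have := Real.sq_sqrt (show 0 ≤ a ^ 2 + 4 * b by positivity)
  unfold eig
  linear_combination this / 4

theorem eig_lt (h : (a, b) ∈ S) : eig a b < -1 := by
  obtain ⟨h1, -, h3, -⟩ := S_bounds h
  have : a ≤ √(a ^ 2 + 4 * b) := Real.le_sqrt_of_sq_le (by linarith)
  unfold eig
  linarith

theorem L_localPt (h : (a, b) ∈ S) {s : ℝ} (hs : |s| ≤ 1 / (1 + a - b)) :
    L a b (localPt a b s) = localPt a b (eig a b * s) := by
  have h2 := eig_sq h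
  have h3 := eig_lt h
  obtain ⟨-, -, -, hD⟩ := S_bounds h
  have h0 : 0 ≤ 1 / (1 + a - b) + s := by linarith [(abs_le.mp hs).1]
  have hne : eig a b ≠ 0 := by linarith
  unfold L localPt
  simp only [abs_of_nonneg h0, Prod.mk.injEq]
  constructor
  · field_simp
    linear_combination (-s * (1 + a - b)) * h2
  · field_simp

theorem iterate_localPt (h : (a, b) ∈ S) (t : ℝ) {n : ℕ}
    (hn : |t / eig a b ^ n| ≤ 1 / (1 + a - b)) (k : ℕ) :
    (L a b)^[n + k] (localPt a b (t / eig a b ^ (n + k)))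
      = (L a b)^[n] (localPt a b (t / eig a b ^ n)) := by
  have h3 := eig_lt h
  have hne : eig a b ≠ 0 := by linarith
  induction k with
  | zero => rfl
  | succ k ih =>
    rw [← ih, ← add_assoc, Function.iterate_succ_apply, L_localPt h]
    · congr 2
      rw [pow_succ]
      field_simp
    · refine le_trans ?_ hn
      rw [add_assoc, pow_add, ← div_div, abs_div]
      refine div_le_self (abs_nonneg _) ?_
      rw [abs_pow]
      exact one_le_pow₀ (by rw [abs_of_neg (by linarith)]; linarith)

/-- The sequence defining `param` is constant from every index on at which the starting point
lies close enough to `X`. -/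
theorem param_eq (h : (a, b) ∈ S) {t : ℝ} {n : ℕ} (hn : |t / eig a b ^ n| ≤ 1 / (1 + a - b)) :
    param a b t = (L a b)^[n] (localPt a b (t / eig a b ^ n)) := by
  refine Tendsto.limUnder_eq (tendsto_const_nhds.congr' ?_)
  filter_upwards [eventually_ge_atTop n] with m hm
  obtain ⟨k, rfl⟩ := Nat.exists_eq_add_of_le hm
  exact (iterate_localPt h t hn k).symm

theorem eventually_small (h : (a, b) ∈ S) (M : ℝ) :
    ∃ n : ℕ, ∀ t, |t| ≤ M → |t / eig a b ^ n| ≤ 1 / (1 + a - b) := by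
  have h3 := eig_lt h
  obtain ⟨-, -, -, hD⟩ := S_bounds h
  have habs : 1 < |eig a b| := by rw [abs_of_neg (by linarith)]; linarith
  obtain ⟨n, hn⟩ := pow_unbounded_of_one_lt (M * (1 + a - b)) habs
  refine ⟨n, fun t ht => ?_⟩
  rw [abs_div, abs_pow, div_le_div_iff₀ (by positivity) hD, one_mul]
  nlinarith

/-- Near `X`, the curve is the straight segment in the unstable direction. -/
theorem param_eq_localPt (h : (a, b) ∈ S) {t : ℝ} (ht : |t| ≤ 1 / (1 + a - b)) :
    param a b t = localPt a b t := by
  simpa using param_eq h (t := t) (n := 0) (by simpa using ht)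

theorem param_zero (h : (a, b) ∈ S) : param a b 0 = X a b := by
  obtain ⟨-, -, -, hD⟩ := S_bounds h
  rw [param_eq_localPt h (by rw [abs_zero]; positivity)]
  simp [localPt, X]

theorem L_param (h : (a, b) ∈ S) (t : ℝ) : L a b (param a b t) = param a b (eig a b * t) := by
  have h3 := eig_lt h
  have hne : eig a b ≠ 0 := by linarith
  obtain ⟨n, hn⟩ := eventually_small h |t|
  have h1 := hn t le_rfl
  have e : eig a b * t / eig a b ^ (n + 1) = t / eig a b ^ n := by
    rw [pow_succ]; field_simp
  rw [param_eq h h1, param_eq h (n := n + 1) (by rw [e]; exact h1), e,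
    Function.iterate_succ_apply']

theorem continuous_L : Continuous (L a b) := by
  unfold L; fun_prop

theorem continuous_Linv : Continuous (Linv a b) := by
  unfold Linv; simp only [div_eq_mul_inv]; fun_prop

theorem continuous_param (h : (a, b) ∈ S) : Continuous (param a b) := by
  rw [continuous_iff_continuousAt]
  intro t
  obtain ⟨n, hn⟩ := eventually_small h (|t| + 1)
  have hc : Continuous fun s => (L a b)^[n] (localPt a b (s / eig a b ^ n)) := by
    refine (continuous_L.iterate n).comp ?_
    unfold localPt; fun_prop
  refine hc.continuousAt.congr ?_
  have : ∀ᶠ s in 𝓝 t, |s| < |t| + 1 :=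
    (continuous_abs.tendsto t).eventually (gt_mem_nhds (by linarith))
  filter_upwards [this] with s hs
  exact (param_eq h (hn s hs.le)).symm

theorem param_injective (h : (a, b) ∈ S) : Function.Injective (param a b) := by
  intro s t hst
  obtain ⟨hb, -, -, -⟩ := S_bounds h
  have h3 := eig_lt h
  have hne : eig a b ≠ 0 := by linarith
  obtain ⟨n, hn⟩ := eventually_small h (max |s| |t|)
  rw [param_eq h (hn s (le_max_left _ _)), param_eq h (hn t (le_max_right _ _))] at hst
  have hinj : Function.Injective (L a b) :=
    Function.LeftInverse.injective (Linv_L hb.ne')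
  have := congrArg Prod.fst (hinj.iterate n hst)
  simp only [localPt, add_right_inj] at this
  field_simp at this
  exact this

/-- The parametrized curve is the whole unstable manifold of `X`. -/
theorem range_param (h : (a, b) ∈ S) : Set.range (param a b) = R a b := by
  obtain ⟨hb, hb1, ha, hD⟩ := S_bounds h
  have hb0 := hb.ne'
  have h2 := eig_sq h
  have h3 := eig_lt h
  have hne : eig a b ≠ 0 := by linarith
  have hinv : ∀ t, Linv a b (param a b t) = param a b (t / eig a b) := by
    intro t
    conv_lhs => rw [show t = eig a b * (t / eig a b) by field_simp, ← L_param h]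
    exact Linv_L hb0 _
  ext P
  constructor
  · rintro ⟨t, rfl⟩
    have hit : ∀ n : ℕ, (Linv a b)^[n] (param a b t) = param a b (t / eig a b ^ n) := by
      intro n
      induction n with
      | zero => simp
      | succ n ih => rw [Function.iterate_succ_apply', ih, hinv, pow_succ, div_div]
    change Tendsto _ _ _
    simp only [hit]
    rw [← param_zero h]
    refine ((continuous_param h).tendsto 0).comp ?_
    have : Tendsto (fun n : ℕ => t * (eig a b)⁻¹ ^ n) atTop (𝓝 (t * 0)) := by
      refine Tendsto.const_mul t (tendsto_pow_atTop_nhds_zero_of_abs_lt_one ?_)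
      rw [abs_inv, abs_of_neg (by linarith)]
      exact inv_lt_one_of_one_lt₀ (by linarith)
    simpa [div_eq_mul_inv] using this
  · intro hP
    change Tendsto _ _ _ at hP
    set u : ℕ → ℝ × ℝ := fun n => (Linv a b)^[n] P with hu
    have hL : ∀ n, L a b (u (n + 1)) = u n := fun n => by
      rw [hu]; simp only [Function.iterate_succ_apply']; exact L_Linv hb0 _
    have hx : Tendsto (fun n => (u n).1) atTop (𝓝 (1 / (1 + a - b))) :=
      (continuous_fst.tendsto _).comp hP
    have hy : Tendsto (fun n => (u n).2) atTop (𝓝 (b / (1 + a - b))) :=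
      (continuous_snd.tendsto _).comp hP
    -- The component of `u n - X` along the stable direction, up to a constant factor.
    set c : ℕ → ℝ := fun n =>
      ((u n).2 - b / (1 + a - b)) - b / eig a b * ((u n).1 - 1 / (1 + a - b)) with hc
    have hpos : ∀ᶠ n in atTop, 0 < (u n).1 := hx.eventually (lt_mem_nhds (by positivity))
    obtain ⟨N, hN⟩ := eventually_atTop.mp hpos
    have hrec : ∀ n, N ≤ n → c n = -(b / eig a b) * c (n + 1) := by
      intro n hn
      have e := hL n
      have hp := hN (n + 1) (by omega)
      rw [hc]
      simp only
      rw [← e]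
      simp only [L, abs_of_pos hp]
      field_simp
      linear_combination ((u (n + 1)).1 * (1 + a - b) - 1) * h2
    have hc0 : Tendsto c atTop (𝓝 0) := by
      have := (hy.sub_const (b / (1 + a - b))).sub
        ((hx.sub_const (1 / (1 + a - b))).const_mul (b / eig a b))
      rwa [sub_self, sub_self, mul_zero, sub_zero] at this
    have hbnd : ∀ n k, N ≤ n → |c n| ≤ |c (n + k)| := by
      intro n k hn
      induction k with
      | zero => rfl
      | succ k ih =>
        refine ih.trans ?_
        rw [hrec (n + k) (by omega), abs_mul, ← add_assoc]
        refine mul_le_of_le_one_left (abs_nonneg _) ?_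
        rw [abs_neg, abs_div, abs_of_pos hb, abs_of_neg (by linarith),
          div_le_one (by linarith)]
        linarith
    have hcz : ∀ n, N ≤ n → c n = 0 := by
      intro n hn
      have ht : Tendsto (fun k => |c (n + k)|) atTop (𝓝 0) := by
        have := (continuous_abs.tendsto 0).comp hc0
        rw [abs_zero] at this
        refine this.comp (tendsto_atTop_mono (fun k => Nat.le_add_left k n) tendsto_id)
      have := ge_of_tendsto' ht (fun k => hbnd n k hn)
      exact abs_eq_zero.mp (le_antisymm this (abs_nonneg _))
    have hsm : ∀ᶠ n in atTop, |(u n).1 - 1 / (1 + a - b)| < 1 / (1 + a - b) := by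
      have hx0 := hx.sub_const (1 / (1 + a - b))
      rw [sub_self] at hx0
      have := (continuous_abs.tendsto 0).comp hx0
      rw [abs_zero] at this
      exact this.eventually (gt_mem_nhds (by positivity))
    obtain ⟨n, hn1, hn2⟩ := (hsm.and (eventually_ge_atTop N)).exists
    set s := (u n).1 - 1 / (1 + a - b) with hs
    have hun : u n = param a b s := by
      rw [param_eq_localPt h hn1.le]
      have := hcz n hn2
      rw [hc] at this
      simp only at this
      unfold localPt
      ext
      · simp [hs]
      · simp only
        linear_combination this
    have hback : ∀ k, ∀ Q : ℝ × ℝ, (∃ t, param a b t = Q) →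
        ∃ t, param a b t = (L a b)^[k] Q := by
      intro k
      induction k with
      | zero => intro Q hQ; exact hQ
      | succ k ih =>
        rintro Q hQ
        obtain ⟨t, ht⟩ := ih Q hQ
        exact ⟨eig a b * t, by rw [Function.iterate_succ_apply', ← ht, L_param h]⟩
    obtain ⟨t, ht⟩ := hback n (u n) ⟨s, hun.symm⟩
    refine ⟨t, ht.trans ?_⟩
    exact (Function.LeftInverse.iterate (f := Linv a b) (g := L a b) (L_Linv hb0) n) P

end ParamFacts

/-! ## The order on `R`, arcs, and basic points -/

/-- The strict order on `R`: the order of the real line, with the part of `R` that leaves `X` to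
the right being the positive half-line. -/
def Before (a b : ℝ) (P Q : ℝ × ℝ) : Prop := ∃ s t, s < t ∧ param a b s = P ∧ param a b t = Q

/-- The arc `[P, Q]` of `R`. -/
def arc (a b : ℝ) (P Q : ℝ × ℝ) : Set (ℝ × ℝ) :=
  {W | ∃ s u t, s ≤ u ∧ u ≤ t ∧ param a b s = P ∧ param a b u = W ∧ param a b t = Q}

/-- The gluing points: points of `R` on the vertical axis all of whose proper preimages
`L^{-k}`, `k ≥ 1`, lie off that axis. -/
def gluingPts (a b : ℝ) : Set (ℝ × ℝ) :=
  {P | P ∈ R a b ∧ P.1 = 0 ∧ ∀ k : ℕ, 1 ≤ k → ((Linv a b)^[k] P).1 ≠ 0}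

/-- The turning points: the images of the gluing points. -/
def turningPts (a b : ℝ) : Set (ℝ × ℝ) := L a b '' gluingPts a b

/-- The postturning points: the images `L^j(T)`, `j ≥ 1`, of turning points. -/
def postturningPts (a b : ℝ) : Set (ℝ × ℝ) :=
  {P | ∃ T ∈ turningPts a b, ∃ j : ℕ, 1 ≤ j ∧ (L a b)^[j] T = P}

/-- The basic points. -/
def basicPts (a b : ℝ) : Set (ℝ × ℝ) := gluingPts a b ∪ turningPts a b ∪ postturningPts a b

/-- `E` enumerates the basic points in their order on `R`, with `E_0 = G_0 = L^{-1}(Z)`. -/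
def IsBasicEnum (a b : ℝ) (E : ℤ → ℝ × ℝ) : Prop :=
  (∀ i j, i < j → Before a b (E i) (E j)) ∧ Set.range E = basicPts a b ∧ E 0 = Linv a b (Z a b)

/-- The enumeration `(E_i)` of the basic points. -/
noncomputable def E (a b : ℝ) : ℤ → ℝ × ℝ := Classical.epsilon (IsBasicEnum a b)

/-! ## Kneading sequences -/

/-- `p` (a bi-infinite sequence of signs `±1`) is an itinerary of `P`: `p_n = -1` only if
`L^n(P)` has `x ≤ 0`, and `p_n = +1` only if it has `x ≥ 0`. -/
def IsItinerary (a b : ℝ) (P : ℝ × ℝ) (p : ℤ → ℤˣ) : Prop :=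
  ∀ n, 0 ≤ ((p n : ℤ) : ℝ) * (iter a b n P).1

/-- `p` is an essential itinerary of the point `P` of `R`: if `L^l(P)` lies on the vertical axis
and so does `L^k(P)` for some `k < l`, then `p_l` is the sign of the `x`-coordinate of `L^l(Q)`
for the points `Q ≠ P` of `R` that are close to `P` along `R`. (At the first visit to the
vertical axis both signs are allowed.) -/
def IsEssItinerary (a b : ℝ) (P : ℝ × ℝ) (p : ℤ → ℤˣ) : Prop :=
  IsItinerary a b P p ∧
    ∀ k l : ℤ, k < l → (iter a b k P).1 = 0 → (iter a b l P).1 = 0 →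
      ∀ t, param a b t = P →
        ∀ᶠ s in 𝓝[≠] t, 0 < ((p l : ℤ) : ℝ) * (iter a b l (param a b s)).1

/-- The kneading set: the set of all (essential) itineraries of turning points. -/
def kneadingSet (a b : ℝ) : Set (ℤ → ℤˣ) :=
  {p | ∃ T ∈ turningPts a b, IsEssItinerary a b T p}

/-! ## The folding pattern -/

/-- The letters `G` and `T` of a folding pattern. -/
inductive Letter
  | G
  | T

open Classical in
/-- The folding pattern: its `i`-th letter is `G` if `E_i` is a gluing point and `T` otherwise,
that is, if `E_i` is a turning or postturning point. The symbol `X` stands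
between the letters with the numbers `0` and `1`. -/
noncomputable def foldingPattern (a b : ℝ) (i : ℤ) : Letter :=
  if E a b i ∈ gluingPts a b then Letter.G else Letter.T

/-! ## The folding tree -/

/-- The folding tree: the Markov graph of the basic arcs. The vertex `i` stands for
`[E_i, E_{i+1}]`, and there is an arrow from `i` to `j` iff
`L([E_i, E_{i+1}]) ⊇ [E_j, E_{j+1}]`. -/
def foldingTree (a b : ℝ) (i j : ℤ) : Prop :=
  arc a b (E a b j) (E a b (j + 1)) ⊆ L a b '' arc a b (E a b i) (E a b (i + 1))

/-- `AtLevel A n i`: in the graph `A` on `ℤ`, the vertex `i` is at level `n`. The vertex `0` is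
at level `0`, and a vertex reached from `-1` by a path of `n` arrows is at level `n + 1`. -/
inductive AtLevel (A : ℤ → ℤ → Prop) : ℕ → ℤ → Prop
  | root : AtLevel A 0 0
  | one : AtLevel A 1 (-1)
  | step {n : ℕ} {i j : ℤ} : AtLevel A (n + 1) i → A i j → AtLevel A (n + 2) j

/-- The graphs `A` and `B` on `ℤ` agree as graphs embedded in the plane, with the numbers of the
vertices forgotten: there is an isomorphism of graphs that preserves the order from left to
right (that is, by increasing modulus) of the vertices of each level. -/
def SamePlaneTree (A B : ℤ → ℤ → Prop) : Prop :=
  ∃ φ : ℤ ≃ ℤ, (∀ i j, A i j ↔ B (φ i) (φ j)) ∧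
    ∀ n i j, AtLevel A n i → AtLevel A n j → (|i| < |j| ↔ |φ i| < |φ j|)

end Lozi

/-! Write λ for `eig a b`, so λ < -1. In the parameter of `param` the map `L` on `R` is
multiplication by λ. The parameters of the basic points (`bas`) form a locally finite subset of the
line, unbounded on both sides, so the integers enumerate it by an increasing `e`. Multiplication by
λ acts on indices as a strictly decreasing `σ` with `σ 0 = 1` and `σ 1 = -1` (`BasicEnum`). Each of
the four invariants turns out to be equivalent to `σ`.

Pattern and tree: a basic point that is not a gluing point is the image of a basic point, so the
letters T mark the range of `σ`, and a decreasing map with `σ 0 = 1` is determined by its range. The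
arrows from `i` lead to the integers in `[σ (i + 1), σ i)`, which gives `σ` back. Without the
numbers, the levels are still nonempty integer intervals lying alternately left and right of 0, each
adjacent to the one two levels earlier, so the order within levels restores the numbering
(`plane_iso_eq_id`).

From `σ` to kneading: the sign of the first coordinate on the gaps between basic points is + around
`X` and changes exactly at gluing points. Moreover `σ` determines the order of all λ^m `e i`, even
for negative m, hence the gap in which each past image lies (`BasicEnum.kneadingSet_subset`).

From kneading to `σ`: both branches of `L` preserve a cone and expand first coordinates there by at
least √2, while `R` is bounded. Hence points with a common itinerary coincide (`eq_of_itinerary`),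
and the first difference of two itineraries decides the order of the points in the same way for all
parameters (`same_order`). Matching images of gluing points by itineraries gives an increasing
bijection between the basic points of the two maps, which respects gluing points and the two sides
of `X` (`BasicEnum.range_eq_of_kneadingSet_eq`). -/

namespace Lozi

/-! ### The Lozi map as multiplication by the unstable eigenvalue -/

section Parametrization

variable {a b : ℝ}

/-- The first coordinate along the parametrization of `R`. -/
noncomputable def xc (a b t : ℝ) : ℝ := (param a b t).1

theorem eig_ne (h : (a, b) ∈ S) : eig a b ≠ 0 := by linarith [eig_lt h]

theorem continuous_xc (h : (a, b) ∈ S) : Continuous (xc a b) :=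
  continuous_fst.comp (continuous_param h)

theorem Linv_param (h : (a, b) ∈ S) (t : ℝ) :
    Linv a b (param a b t) = param a b ((eig a b)⁻¹ * t) := by
  have hne := eig_ne h
  conv_lhs => rw [show t = eig a b * ((eig a b)⁻¹ * t) by field_simp, ← L_param h]
  exact Linv_L (S_bounds h).1.ne' _

theorem Linv_iterate_param (h : (a, b) ∈ S) (n : ℕ) (t : ℝ) :
    (Linv a b)^[n] (param a b t) = param a b (eig a b ^ (-(n : ℤ)) * t) := by
  induction n with
  | zero => simp
  | succ n ih =>
    rw [Function.iterate_succ_apply', ih, Linv_param h]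
    congr 1
    rw [show -((n + 1 : ℕ) : ℤ) = -1 + -(n : ℤ) by push_cast; ring, zpow_add₀ (eig_ne h),
      zpow_neg_one, mul_assoc]

theorem L_iterate_param (h : (a, b) ∈ S) (n : ℕ) (t : ℝ) :
    (L a b)^[n] (param a b t) = param a b (eig a b ^ (n : ℤ) * t) := by
  induction n with
  | zero => simp
  | succ n ih =>
    rw [Function.iterate_succ_apply', ih, L_param h]
    congr 1
    rw [show ((n + 1 : ℕ) : ℤ) = 1 + (n : ℤ) by push_cast; ring, zpow_add₀ (eig_ne h),
      zpow_one, mul_assoc]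

theorem iter_param (h : (a, b) ∈ S) (n : ℤ) (t : ℝ) :
    iter a b n (param a b t) = param a b (eig a b ^ n * t) := by
  cases n with
  | ofNat n => exact L_iterate_param h n t
  | negSucc n => exact Linv_iterate_param h (n + 1) t

theorem eig_zpow_succ (h : (a, b) ∈ S) (n : ℤ) (t : ℝ) :
    eig a b ^ (n + 1) * t = eig a b * (eig a b ^ n * t) := by
  rw [zpow_add_one₀ (eig_ne h)]; ring

/-- Far enough in the past, all points of a bounded arc lie in the local unstable segment. -/
theorem exists_zpow_small (h : (a, b) ∈ S) (M : ℝ) :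
    ∃ N : ℤ, ∀ k ≤ N, ∀ t, |t| ≤ M → |eig a b ^ k * t| < 1 / (1 + a - b) := by
  have h3 := eig_lt h
  obtain ⟨-, -, -, hD⟩ := S_bounds h
  have habs : 1 < |eig a b| := by rw [abs_of_neg (by linarith)]; linarith
  obtain ⟨n, hn⟩ := pow_unbounded_of_one_lt (M * (1 + a - b)) habs
  refine ⟨-(n : ℤ), fun k hk t ht => ?_⟩
  have h1 : |eig a b| ^ k ≤ |eig a b| ^ (-(n : ℤ)) := zpow_le_zpow_right₀ habs.le hk
  rw [abs_mul, abs_zpow]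
  have h2 : |eig a b| ^ k * |t| ≤ |eig a b| ^ (-(n : ℤ)) * M := by gcongr
  refine h2.trans_lt ?_
  rw [zpow_neg, zpow_natCast, inv_mul_eq_div, div_lt_div_iff₀ (by positivity) hD, one_mul]
  exact hn

theorem xc_eq (h : (a, b) ∈ S) {t : ℝ} (ht : |t| ≤ 1 / (1 + a - b)) :
    xc a b t = 1 / (1 + a - b) + t := by
  unfold xc; rw [param_eq_localPt h ht]; rfl

theorem xc_pos_of_small (h : (a, b) ∈ S) {t : ℝ} (ht : |t| < 1 / (1 + a - b)) :
    0 < xc a b t := by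
  rw [xc_eq h ht.le]; linarith [(abs_lt.mp ht).1]

end Parametrization

/-! ### Boundedness of the unstable manifold by a trapping triangle -/

section Bounded

variable {a b : ℝ}

/-- Squaring shows that the condition `2 * a + b < 4` is this bound in disguise; it puts the image
of `Z` on the right side of the stable line in `L_mem_trap`. -/
theorem eig_gt (h : (a, b) ∈ S) : -2 < eig a b := by
  obtain ⟨hb, -, ha, -⟩ := S_bounds h
  obtain ⟨-, -, -, h4⟩ := h
  simp only at h4
  have : √(a ^ 2 + 4 * b) < 4 - a := by
    rw [Real.sqrt_lt' (by linarith)]; nlinarith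
  unfold eig; linarith

/-- A region that is mapped into itself by the Lozi map: the triangle whose sides lie on the
line through `X` in the unstable direction, on the image of that line, and on the stable line of
the fixed point in the third quadrant. Here `l` is the modulus of the unstable eigenvalue, and
`w = l / (l - b)` is the first coordinate of `Z`. -/
def trap (b l w : ℝ) : Set (ℝ × ℝ) :=
  {P | l * P.2 + b * P.1 ≤ b * w ∧ -l ≤ (l - 1) * (l * P.1 + P.2) ∧
    b * l * P.1 - (l ^ 2 - 2 * b) * P.2 ≤ b * l * w}

/-- Eliminating the second coordinate from the first and third inequalities leaves this bound; the
two sides meet at the vertex `(w, 0)`. -/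
theorem fst_le_of_mem_trap {l w : ℝ} (hb : 0 < b) (hl : 1 < l) (hm : 0 < l ^ 2 - 2 * b)
    {P : ℝ × ℝ} (hP : P ∈ trap b l w) : P.1 ≤ w := by
  obtain ⟨x, y⟩ := P
  obtain ⟨h1, -, h3⟩ := hP
  simp only at h1 h3 ⊢
  have h4 := mul_le_mul_of_nonneg_left h1 hm.le
  have h5 := mul_le_mul_of_nonneg_left h3 (show 0 ≤ l by linarith)
  have h6 : 0 < b * (2 * (l ^ 2 - b)) := by
    apply mul_pos hb; nlinarith
  refine le_of_mul_le_mul_left ?_ h6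
  linear_combination h4 + h5

/-- The first and third inequalities for the image follow from the first one for `P` and `|x| ≥ ±
x`. For the second, the stable line is invariant under the left branch, and under the right branch
the third side is the one that matters. -/
theorem L_mem_trap {l w : ℝ} (hb : 0 < b) (hl : 1 < l) (hl2 : l ≤ 2) (ha : 0 < a)
    (hsq : l ^ 2 = b + a * l) (hm : 0 < l ^ 2 - 2 * b) (hlb : 2 * b ≤ l) (hw : l + b * w = l * w)
    {P : ℝ × ℝ} (hP : P ∈ trap b l w) : L a b P ∈ trap b l w := by
  have hxw := fst_le_of_mem_trap hb hl hm hP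
  obtain ⟨x, y⟩ := P
  obtain ⟨h1, h2, h3⟩ := hP
  simp only at h1 h2 h3 hxw
  have hl0 : 0 < l := by linarith
  have hal : 0 < a * l := mul_pos ha hl0
  have habs : 0 ≤ a * l * (|x| - x) := mul_nonneg hal.le (by linarith [le_abs_self x])
  have habs' : 0 ≤ a * l * (|x| + x) := mul_nonneg hal.le (by linarith [neg_abs_le x])
  have hlb' : 0 < l - b := by linarith
  have hw' : (l - b) * w = l := by linear_combination -hw
  have hw0 : 0 < w := by
    by_contra hn
    nlinarith
  have hlsq : 0 < l ^ 2 - b := by linarith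
  simp only [L, trap, Set.mem_ofPred_eq]
  refine ⟨?_, ?_, ?_⟩
  · refine le_of_mul_le_mul_left ?_ hl0
    have h4 := mul_le_mul_of_nonneg_left h1 hb.le
    have h5 := mul_nonneg hb.le habs
    linear_combination h4 + h5 + b * x * hsq + b * hw
  · rcases le_total x 0 with hx | hx
    · rw [abs_of_nonpos hx]
      linear_combination l * h2 + (l - 1) * x * hsq
    · rw [abs_of_nonneg hx]
      -- For `x ≥ 0` the worst points lie on the third side, where the claim is affine in `x`. So it
      -- suffices to check the ends `x = 0` (`hA`) and `x = w` (`hB`); after multiplication by `l -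
      -- b` they factor through `l - 2 * b` and `2 - l`.
      have hA : 0 ≤ l ^ 2 - 2 * b - (l - 1) * b * w := by
        refine nonneg_of_mul_nonneg_right (b := l ^ 2 - 2 * b - (l - 1) * b * w) ?_ hlb'
        have : 0 ≤ (l - 2 * b) * (l ^ 2 - b) := mul_nonneg (by linarith) hlsq.le
        linear_combination this + (l - 1) * b * hw'
      have hB : 0 ≤ l ^ 2 - (l - 1) * (l ^ 2 - 2 * b) * w := by
        refine nonneg_of_mul_nonneg_right (b := l ^ 2 - (l - 1) * (l ^ 2 - 2 * b) * w) ?_ hlb'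
        have : 0 ≤ l * ((2 - l) * (l ^ 2 - b)) :=
          mul_nonneg hl0.le (mul_nonneg (by linarith) hlsq.le)
        linear_combination this + (l - 1) * (l ^ 2 - 2 * b) * hw'
      refine le_of_mul_le_mul_left ?_ (mul_pos hm hw0)
      have h4 := mul_nonneg (mul_nonneg (sub_nonneg.2 hxw) (sq_nonneg l)) hA
      have h5 := mul_nonneg (mul_nonneg hx hm.le) hB
      have h6 := mul_le_mul_of_nonneg_left h3
        (mul_nonneg (mul_nonneg (show 0 ≤ l - 1 by linarith) hl0.le) hw0.le)
      linear_combination h4 + h5 + h6 - (l ^ 2 - 2 * b) * w * (l - 1) * x * hsq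
  · have h4 := mul_le_mul_of_nonneg_left h1 hb.le
    have h5 := mul_nonneg hb.le habs'
    linear_combination h4 + h5 + b * hw - b * x * hsq

/-- The unstable manifold of `X` is bounded. -/
theorem exists_bound_xc (h : (a, b) ∈ S) : ∃ C, ∀ t, |xc a b t| ≤ C := by
  obtain ⟨hb, hb1, ha, hD⟩ := S_bounds h
  have hsq := eig_sq h
  have h3 := eig_lt h
  have h2 := eig_gt h
  set l : ℝ := -eig a b with hl
  have hel : eig a b = -l := by rw [hl, neg_neg]
  rw [hel] at h3 h2 hsq
  have hl1 : 1 < l := by linarith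
  have hl2 : l < 2 := by linarith
  have hsq' : l ^ 2 = b + a * l := by linear_combination hsq
  have hs : √2 < 3 / 2 := by
    rw [Real.sqrt_lt' (by norm_num)]; norm_num
  have hS := h
  obtain ⟨-, c2, -, c4⟩ := h
  simp only at c2 c4
  have c2' : b + 2 < a * (3 / 2) := by nlinarith
  have hla : a < l := by nlinarith
  have hlb : 2 * b ≤ l := by linarith
  have hm : 0 < l ^ 2 - 2 * b := by nlinarith
  have hlb' : 0 < l - b := by linarith
  set c : ℝ := 1 / (1 + a - b) with hc
  have hc0 : 0 < c := by positivity
  have hcD : c * (1 + a - b) = 1 := by rw [hc]; field_simp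
  have hw : l + b * ((1 + l) * c) = l * ((1 + l) * c) := by
    linear_combination -l * hcD - c * hsq'
  have key : ∀ t, param a b t ∈ trap b l ((1 + l) * c) := by
    intro t
    obtain ⟨n, hn⟩ := eventually_small hS |t|
    replace hn := hn t le_rfl
    rw [param_eq hS hn]
    generalize t / eig a b ^ n = s at hn
    have h0 : localPt a b s ∈ trap b l ((1 + l) * c) := by
      obtain ⟨s1, s2⟩ := abs_le.mp hn
      have e1 : b / (1 + a - b) = b * c := by rw [hc]; ring
      have hl0 : l ≠ 0 := by linarith
      simp only [localPt, trap, Set.mem_ofPred_eq, hel, e1]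
      rw [← hc] at hn s1 s2 ⊢
      have e2 : s * (b / -l) = -(b * (s / l)) := by field_simp
      have e3 : l * (s / l) = s := by field_simp
      have s1' : -c ≤ s / l := by rw [le_div_iff₀ (by linarith)]; nlinarith
      have s2' : s / l ≤ c := by rw [div_le_iff₀ (by linarith)]; nlinarith
      rw [e2]
      -- With `s = l * r` the local point is `(c + l * r, b * (c - r))`, where `|r| ≤ c`.
      generalize s / l = r at *
      subst e3
      refine ⟨by linarith, ?_, ?_⟩
      · have e4 : 0 ≤ (l - 1) * (l * (c + l * r) + b * (c - r)) := by
          apply mul_nonneg (by linarith)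
          exact add_nonneg (mul_nonneg (by linarith) (by linarith))
            (mul_nonneg hb.le (by linarith))
        have e5 : 0 ≤ l := by linarith
        linear_combination e4 + e5
      · have e4 : 0 ≤ (l ^ 2 - 2 * b) * (b * (c - r)) :=
          mul_nonneg hm.le (mul_nonneg hb.le (by linarith))
        have e5 : c + l * r ≤ (1 + l) * c := by nlinarith
        have e6 := mul_le_mul_of_nonneg_left e5 (show 0 ≤ b * l by positivity)
        linear_combination e4 + e6
    clear hn
    induction n with
    | zero => exact h0
    | succ n ih =>
      rw [Function.iterate_succ_apply']
      exact L_mem_trap hb hl1 hl2.le (by linarith) hsq' hm hlb hw ih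
  -- The second summand bounds the first coordinate from below: it comes from eliminating the second
  -- coordinate from the first two sides.
  refine ⟨(1 + l) * c + (l ^ 2 / (l - 1) + b * ((1 + l) * c)) / (l ^ 2 - b), fun t => ?_⟩
  have h1 := fst_le_of_mem_trap hb hl1 hm (key t)
  obtain ⟨k1, k2, -⟩ := key t
  change _ ≤ _ at k1 k2
  set w := (1 + l) * c
  have hd : 0 < l ^ 2 - b := by linarith
  have hl1' : 0 < l - 1 := by linarith
  have hw0 : 0 < w := by positivity
  have k3 : -(l ^ 2 / (l - 1)) ≤ l * (l * (param a b t).1 + (param a b t).2) := by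
    rw [← neg_div, div_le_iff₀ hl1']
    have := mul_le_mul_of_nonneg_left k2 (show 0 ≤ l by linarith)
    linear_combination this
  have k4 : -((l ^ 2 / (l - 1) + b * w) / (l ^ 2 - b)) ≤ (param a b t).1 := by
    rw [← neg_div, div_le_iff₀ hd]
    linear_combination k3 + k1
  have k5 : 0 ≤ (l ^ 2 / (l - 1) + b * w) / (l ^ 2 - b) := by positivity
  exact abs_le.mpr ⟨by unfold xc; linarith, by unfold xc; linarith⟩

end Bounded

/-! ### Invariant cones, expansion, and order from itineraries -/

section Cone

variable {a b : ℝ}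

/-- The cone of vectors that are expanded by both branches of the Lozi map. -/
def Cone (a : ℝ) (v : ℝ × ℝ) : Prop := v.1 ≠ 0 ∧ |v.2| ≤ (a - √2) * |v.1|

theorem units_cast_cases (q : ℤˣ) : ((q : ℤ) : ℝ) = 1 ∨ ((q : ℤ) : ℝ) = -1 := by
  rcases Int.units_eq_one_or q with rfl | rfl <;> simp

theorem units_eq_of_mul_pos {q r : ℤˣ} {x : ℝ} (hq : 0 < ((q : ℤ) : ℝ) * x)
    (hr : 0 ≤ ((r : ℤ) : ℝ) * x) : r = q := by
  rcases Int.units_eq_one_or q with rfl | rfl <;> rcases Int.units_eq_one_or r with rfl | rfl <;>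
    simp at * <;> linarith

theorem exists_units_mul_pos {x : ℝ} (hx : x ≠ 0) : ∃ q : ℤˣ, 0 < ((q : ℤ) : ℝ) * x := by
  rcases hx.lt_or_gt with hx | hx
  · exact ⟨-1, by simpa using hx⟩
  · exact ⟨1, by simpa using hx⟩

/-- A vector of slope at most `κ = a - √2` is stretched horizontally by at least `a - κ = √2`, so
its image has slope at most `b / √2`. The second inequality, a form of `b + 2 < a * √2`, says that
this is again at most `κ`. -/
theorem slope_bounds (h : (a, b) ∈ S) : 0 < a - √2 ∧ b ≤ √2 * (a - √2) := by
  obtain ⟨hb, h2, -, -⟩ := h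
  simp only at hb h2
  have hs : √2 * √2 = 2 := Real.mul_self_sqrt (by norm_num)
  have hs0 : 0 < √2 := by positivity
  constructor
  · by_contra hn
    nlinarith
  · linarith

/-- One step of the Lozi map on the difference of two points in a common half-plane. -/
theorem cone_step (h : (a, b) ∈ S) {P Q : ℝ × ℝ} (q : ℤˣ) (hP : 0 ≤ ((q : ℤ) : ℝ) * P.1)
    (hQ : 0 ≤ ((q : ℤ) : ℝ) * Q.1) (hc : Cone a (Q - P)) :
    Cone a (L a b Q - L a b P) ∧ √2 * |(Q - P).1| ≤ |(L a b Q - L a b P).1| ∧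
      (L a b Q - L a b P).1 * (((q : ℤ) : ℝ) * (Q - P).1) < 0 := by
  obtain ⟨k1, k2⟩ := slope_bounds h
  have hb : 0 < b := h.1
  have hs0 : 0 < √2 := by positivity
  obtain ⟨c1, c2⟩ := hc
  set u := (Q - P).1 with hu
  set v := (Q - P).2 with hv
  have hv' : v = Q.2 - P.2 := rfl
  have hu' : u = Q.1 - P.1 := rfl
  have e1 : (L a b Q - L a b P).1 = v - ((q : ℤ) : ℝ) * a * u := by
    simp only [L, Prod.fst_sub, hv', hu']
    rcases units_cast_cases q with e | e <;> rw [e] at hP hQ ⊢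
    · rw [abs_of_nonneg (by linarith : 0 ≤ P.1), abs_of_nonneg (by linarith : 0 ≤ Q.1)]; ring
    · rw [abs_of_nonpos (by linarith : P.1 ≤ 0), abs_of_nonpos (by linarith : Q.1 ≤ 0)]; ring
  have e2 : (L a b Q - L a b P).2 = b * u := by
    simp only [L, Prod.snd_sub, hu']; ring
  have hq2 : ((q : ℤ) : ℝ) * ((q : ℤ) : ℝ) = 1 := by
    rcases units_cast_cases q with e | e <;> rw [e] <;> norm_num
  have hqa : |((q : ℤ) : ℝ)| = 1 := by
    rcases units_cast_cases q with e | e <;> rw [e] <;> norm_num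
  have hupos : 0 < |u| := abs_pos.mpr c1
  have ha : 0 < a := by linarith
  have e3 : √2 * |u| ≤ |v - ((q : ℤ) : ℝ) * a * u| := by
    have := abs_sub_abs_le_abs_sub (((q : ℤ) : ℝ) * a * u) v
    rw [abs_mul, abs_mul, hqa, abs_of_pos ha, abs_sub_comm] at this
    linarith
  refine ⟨⟨?_, ?_⟩, ?_, ?_⟩
  · rw [e1]
    intro h0
    rw [h0, abs_zero] at e3
    nlinarith
  · rw [e1, e2, abs_mul, abs_of_pos hb]
    calc b * |u| ≤ √2 * (a - √2) * |u| := by gcongr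
      _ = (a - √2) * (√2 * |u|) := by ring
      _ ≤ _ := by gcongr
  · rw [e1]; exact e3
  · rw [e1]
    have h4 : ((q : ℤ) : ℝ) * (v * u) ≤ |v| * |u| := by
      rw [← abs_mul, ← one_mul |v * u|, ← hqa, ← abs_mul]; exact le_abs_self _
    have h5 : |v| * |u| ≤ (a - √2) * (|u| * |u|) := by nlinarith
    have h6 : |u| * |u| = u * u := abs_mul_abs_self u
    have h7 : 0 < √2 * (|u| * |u|) := by positivity
    rw [h6] at h5 h7
    linear_combination h4 + h5 + h7 - a * u ^ 2 * hq2

/-- The unstable direction has slope `b / eig a b`, and `|eig a b| ≥ a > √2` puts it in the cone. -/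
theorem cone_local (h : (a, b) ∈ S) {s t : ℝ} (hst : s ≠ t) (hs : |s| ≤ 1 / (1 + a - b))
    (ht : |t| ≤ 1 / (1 + a - b)) : Cone a (param a b t - param a b s) := by
  obtain ⟨k1, k2⟩ := slope_bounds h
  have hb : 0 < b := h.1
  have h3 := eig_lt h
  have hsq := eig_sq h
  have hs0 : 0 < √2 := by positivity
  have hl : √2 ≤ -eig a b := by
    have : a ≤ -eig a b := by nlinarith
    linarith
  rw [param_eq_localPt h hs, param_eq_localPt h ht]
  constructor
  · simpa [localPt, sub_eq_zero] using hst.symm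
  · have e1 : (localPt a b t - localPt a b s).2 = (b / eig a b) * (t - s) := by
      simp only [localPt, Prod.snd_sub]; ring
    have e2 : (localPt a b t - localPt a b s).1 = t - s := by
      simp only [localPt, Prod.fst_sub]; ring
    rw [e1, e2, abs_mul]
    gcongr
    rw [abs_div, abs_of_pos hb, abs_of_neg (by linarith), div_le_iff₀ (by linarith)]
    calc b ≤ (a - √2) * √2 := by linarith
      _ ≤ _ := by gcongr

/-- Two points with the same signs up to (and excluding) time `n` are separated in the direction
of the cone at time `n`. -/
theorem cone_of_agree (h : (a, b) ∈ S) {s t : ℝ} (hst : s ≠ t) (p : ℤ → ℤˣ) (n : ℤ)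
    (hs : ∀ k < n, 0 ≤ ((p k : ℤ) : ℝ) * xc a b (eig a b ^ k * s))
    (ht : ∀ k < n, 0 ≤ ((p k : ℤ) : ℝ) * xc a b (eig a b ^ k * t)) :
    Cone a (param a b (eig a b ^ n * t) - param a b (eig a b ^ n * s)) := by
  obtain ⟨N, hN⟩ := exists_zpow_small h (max |s| |t|)
  have hloc : ∀ k ≤ N, Cone a (param a b (eig a b ^ k * t) - param a b (eig a b ^ k * s)) := by
    intro k hk
    refine cone_local h ?_ (hN k hk s (le_max_left _ _)).le (hN k hk t (le_max_right _ _)).le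
    exact fun e => hst (mul_left_cancel₀ (zpow_ne_zero _ (eig_ne h)) e)
  have key : ∀ k, N ≤ k → k ≤ n →
      Cone a (param a b (eig a b ^ k * t) - param a b (eig a b ^ k * s)) := by
    intro k hk
    induction k, hk using Int.leInduction with
    | base => exact fun _ => hloc N le_rfl
    | succ k hk ih =>
      intro hkn
      rw [eig_zpow_succ h, eig_zpow_succ h, ← L_param h, ← L_param h]
      exact (cone_step h (p k) (hs k (by omega)) (ht k (by omega)) (ih (by omega))).1
  rcases le_total n N with hn | hn
  · exact hloc n hn
  · exact key n hn le_rfl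

/-- For two pairs of points (possibly for different maps) that share their signs before time `n`,
the order along the manifold and the order of first coordinates at time `n` correspond. -/
theorem sign_agree {a' b' : ℝ} (h : (a, b) ∈ S) (h' : (a', b') ∈ S) {s t s' t' : ℝ}
    (hst : s ≠ t) (hst' : s' ≠ t') (p : ℤ → ℤˣ) (n : ℤ)
    (hs : ∀ k < n, 0 ≤ ((p k : ℤ) : ℝ) * xc a b (eig a b ^ k * s))
    (ht : ∀ k < n, 0 ≤ ((p k : ℤ) : ℝ) * xc a b (eig a b ^ k * t))
    (hs' : ∀ k < n, 0 ≤ ((p k : ℤ) : ℝ) * xc a' b' (eig a' b' ^ k * s'))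
    (ht' : ∀ k < n, 0 ≤ ((p k : ℤ) : ℝ) * xc a' b' (eig a' b' ^ k * t')) :
    0 < ((t - s) * (xc a b (eig a b ^ n * t) - xc a b (eig a b ^ n * s))) *
      ((t' - s') * (xc a' b' (eig a' b' ^ n * t') - xc a' b' (eig a' b' ^ n * s'))) := by
  obtain ⟨N₁, hN₁⟩ := exists_zpow_small h (max |s| |t|)
  obtain ⟨N₂, hN₂⟩ := exists_zpow_small h' (max |s'| |t'|)
  -- In the far past both differences of first coordinates are powers of the eigenvalue times
  -- differences of parameters. Both eigenvalues are negative, so the signs of the two powers cancel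
  -- in the product.
  have hneg : ∀ k : ℤ, 0 < eig a b ^ k * eig a' b' ^ k := by
    intro k
    rw [← mul_zpow]
    have := eig_lt h
    have := eig_lt h'
    exact zpow_pos (mul_pos_of_neg_of_neg (by linarith) (by linarith)) _
  have hloc : ∀ k ≤ min N₁ N₂,
      0 < ((t - s) * (xc a b (eig a b ^ k * t) - xc a b (eig a b ^ k * s))) *
      ((t' - s') * (xc a' b' (eig a' b' ^ k * t') - xc a' b' (eig a' b' ^ k * s'))) := by
    intro k hk
    have hk₁ := hk.trans (min_le_left _ _)
    have hk₂ := hk.trans (min_le_right _ _)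
    rw [xc_eq h (hN₁ k hk₁ s (le_max_left _ _)).le, xc_eq h (hN₁ k hk₁ t (le_max_right _ _)).le,
      xc_eq h' (hN₂ k hk₂ s' (le_max_left _ _)).le, xc_eq h' (hN₂ k hk₂ t' (le_max_right _ _)).le]
    have e1 : 0 < (t - s) ^ 2 := by have := sub_ne_zero.2 hst.symm; positivity
    have e2 : 0 < (t' - s') ^ 2 := by have := sub_ne_zero.2 hst'.symm; positivity
    have := mul_pos (hneg k) (mul_pos e1 e2)
    linear_combination this
  have key : ∀ k, min N₁ N₂ ≤ k → k ≤ n →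
      0 < ((t - s) * (xc a b (eig a b ^ k * t) - xc a b (eig a b ^ k * s))) *
      ((t' - s') * (xc a' b' (eig a' b' ^ k * t') - xc a' b' (eig a' b' ^ k * s'))) := by
    intro k hk
    induction k, hk using Int.leInduction with
    | base => exact fun _ => hloc _ le_rfl
    | succ k hk ih =>
      intro hkn
      have ih := ih (by omega)
      have c1 := (cone_step h (p k) (hs k (by omega)) (ht k (by omega))
        (cone_of_agree h hst p k (fun j hj => hs j (by omega)) fun j hj => ht j (by omega))).2.2
      have c2 := (cone_step h' (p k) (hs' k (by omega)) (ht' k (by omega))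
        (cone_of_agree h' hst' p k (fun j hj => hs' j (by omega)) fun j hj => ht' j (by omega))).2.2
      rw [L_param h, L_param h, ← eig_zpow_succ h, ← eig_zpow_succ h] at c1
      rw [L_param h', L_param h', ← eig_zpow_succ h', ← eig_zpow_succ h'] at c2
      have c3 := mul_pos_of_neg_of_neg c1 c2
      simp only [Prod.fst_sub] at c3
      change 0 < (xc a b _ - xc a b _) * (_ * (xc a b _ - xc a b _)) *
        ((xc a' b' _ - xc a' b' _) * (_ * (xc a' b' _ - xc a' b' _))) at c3
      have hq2 : (((p k : ℤˣ) : ℤ) : ℝ) * ((p k : ℤ) : ℝ) = 1 := by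
        rcases units_cast_cases (p k) with e | e <;> rw [e] <;> norm_num
      generalize xc a b (eig a b ^ (k + 1) * t) - xc a b (eig a b ^ (k + 1) * s) = A at *
      generalize xc a' b' (eig a' b' ^ (k + 1) * t') - xc a' b' (eig a' b' ^ (k + 1) * s') = B at *
      generalize xc a b (eig a b ^ k * t) - xc a b (eig a b ^ k * s) = C at *
      generalize xc a' b' (eig a' b' ^ k * t') - xc a' b' (eig a' b' ^ k * s') = D at *
      have c4 := mul_pos ih c3
      have hCD : C * D ≠ 0 := by
        intro e
        have : (t - s) * C * ((t' - s') * D) = 0 := by linear_combination (t - s) * (t' - s') * e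
        linarith
      -- Each step multiplies the sign of either difference by `-p k`; the factor is common to both
      -- maps and drops out of the product.
      refine (mul_pos_iff_of_pos_right (show 0 < (C * D) ^ 2 by positivity)).1 ?_
      linear_combination c4 + (t - s) * (t' - s') * A * B * (C * D) ^ 2 * hq2
  rcases le_total n (min N₁ N₂) with hn | hn
  · exact hloc n hn
  · exact key n hn le_rfl

/-- Points with the same itinerary coincide. -/
theorem eq_of_itinerary (h : (a, b) ∈ S) {s t : ℝ} (p : ℤ → ℤˣ)
    (hs : IsItinerary a b (param a b s) p) (ht : IsItinerary a b (param a b t) p) : s = t := by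
  by_contra hst
  have hs' : ∀ k, 0 ≤ ((p k : ℤ) : ℝ) * xc a b (eig a b ^ k * s) := fun k => by
    have := hs k; rwa [iter_param h] at this
  have ht' : ∀ k, 0 ≤ ((p k : ℤ) : ℝ) * xc a b (eig a b ^ k * t) := fun k => by
    have := ht k; rwa [iter_param h] at this
  have hc := fun k => cone_of_agree h hst p k (fun j _ => hs' j) fun j _ => ht' j
  obtain ⟨C, hC⟩ := exists_bound_xc h
  -- The horizontal distance would grow like `√2 ^ n`, against the boundedness of `R`.
  have hgrow : ∀ n : ℕ, √2 ^ n * |(param a b t - param a b s).1| ≤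
      |xc a b (eig a b ^ (n : ℤ) * t) - xc a b (eig a b ^ (n : ℤ) * s)| := by
    intro n
    induction n with
    | zero => simp [xc]
    | succ n ih =>
      have := (cone_step h (p n) (hs' n) (ht' n) (hc n)).2.1
      rw [L_param h, L_param h, ← eig_zpow_succ h, ← eig_zpow_succ h] at this
      refine le_trans ?_ this
      rw [pow_succ', mul_assoc]
      exact mul_le_mul_of_nonneg_left ih (by positivity)
  have h0 : 0 < |(param a b t - param a b s).1| := by
    have := (hc 0).1
    simpa using this
  obtain ⟨n, hn⟩ := pow_unbounded_of_one_lt (2 * C / |(param a b t - param a b s).1|)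
    (Real.lt_sqrt_of_sq_lt (by norm_num : (1 : ℝ) ^ 2 < 2))
  rw [div_lt_iff₀ h0] at hn
  have h1 := abs_sub (xc a b (eig a b ^ (n : ℤ) * t)) (xc a b (eig a b ^ (n : ℤ) * s))
  linarith [hgrow n, hC (eig a b ^ (n : ℤ) * t), hC (eig a b ^ (n : ℤ) * s)]

/-- Shared itineraries force the same order. -/
theorem same_order {a' b' : ℝ} (h : (a, b) ∈ S) (h' : (a', b') ∈ S) {s t s' t' : ℝ}
    (hst : s ≠ t) (hst' : s' ≠ t') {p q : ℤ → ℤˣ}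
    (hs : IsItinerary a b (param a b s) p) (ht : IsItinerary a b (param a b t) q)
    (hs' : IsItinerary a' b' (param a' b' s') p) (ht' : IsItinerary a' b' (param a' b' t') q) :
    s < t ↔ s' < t' := by
  have hpq : ∃ k, p k ≠ q k := by
    by_contra hn
    push Not at hn
    exact hst (eq_of_itinerary h p hs ((funext hn : p = q) ▸ ht))
  obtain ⟨N, hN⟩ := exists_zpow_small h (max |s| |t|)
  have hs1 : ∀ k, 0 ≤ ((p k : ℤ) : ℝ) * xc a b (eig a b ^ k * s) := fun k => by
    have := hs k; rwa [iter_param h] at this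
  have ht1 : ∀ k, 0 ≤ ((q k : ℤ) : ℝ) * xc a b (eig a b ^ k * t) := fun k => by
    have := ht k; rwa [iter_param h] at this
  have hs2 : ∀ k, 0 ≤ ((p k : ℤ) : ℝ) * xc a' b' (eig a' b' ^ k * s') := fun k => by
    have := hs' k; rwa [iter_param h'] at this
  have ht2 : ∀ k, 0 ≤ ((q k : ℤ) : ℝ) * xc a' b' (eig a' b' ^ k * t') := fun k => by
    have := ht' k; rwa [iter_param h'] at this
  have hbd : ∀ k, p k ≠ q k → N ≤ k := by
    intro k hk
    by_contra hlt
    push Not at hlt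
    apply hk
    have e1 := xc_pos_of_small h (hN k hlt.le s (le_max_left _ _))
    have e2 := xc_pos_of_small h (hN k hlt.le t (le_max_right _ _))
    rw [units_eq_of_mul_pos (q := 1) (by simpa using e1) (hs1 k),
      units_eq_of_mul_pos (q := 1) (by simpa using e2) (ht1 k)]
  -- The first disagreement exists because in the far past all symbols are `1`.
  obtain ⟨n, hn, hmin⟩ := Int.exists_least_of_bdd ⟨N, hbd⟩ hpq
  have heq : ∀ k < n, q k = p k := by
    intro k hk
    by_contra hne
    exact absurd (hmin k (Ne.symm hne)) (by omega)
  have key := sign_agree h h' hst hst' p n (fun k _ => hs1 k)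
    (fun k hk => heq k hk ▸ ht1 k) (fun k _ => hs2 k) (fun k hk => heq k hk ▸ ht2 k)
  have a1 := hs1 n
  have a2 := hs2 n
  have a3 := ht1 n
  have a4 := ht2 n
  generalize xc a b (eig a b ^ n * t) = x at *
  generalize xc a b (eig a b ^ n * s) = y at *
  generalize xc a' b' (eig a' b' ^ n * t') = x' at *
  generalize xc a' b' (eig a' b' ^ n * s') = y' at *
  -- At time `n` the symbols are opposite, so the axis separates the two points weakly, in the same
  -- direction for both maps; `key` excludes equality.
  have hD : 0 ≤ (x - y) * (x' - y') := by
    rcases Int.units_eq_one_or (p n) with e1 | e1 <;>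
    rcases Int.units_eq_one_or (q n) with e2 | e2 <;> rw [e1] at a1 a2 hn <;>
    rw [e2] at a3 a4 hn <;> simp at a1 a2 a3 a4 hn
    · exact mul_nonneg_of_nonpos_of_nonpos (by linarith) (by linarith)
    · exact mul_nonneg (by linarith) (by linarith)
  have h0 : 0 < (t - s) * (t' - s') := by
    refine (mul_pos_iff_of_pos_right (lt_of_le_of_ne hD fun e => ?_)).1
      (show 0 < _ * ((x - y) * (x' - y')) by linarith)
    have : ((t - s) * (x - y)) * ((t' - s') * (x' - y')) = 0 := by
      linear_combination -(t - s) * (t' - s') * e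
    linarith
  constructor <;> intro hlt <;> nlinarith

end Cone

/-! ### Gluing and basic points as parameters on the line -/

section BasicParameters

variable {a b : ℝ}

/-- The parameters of the gluing points. -/
def glu (a b : ℝ) : Set ℝ := {t | xc a b t = 0 ∧ ∀ k : ℤ, k < 0 → xc a b (eig a b ^ k * t) ≠ 0}

/-- The parameters of the basic points. -/
def bas (a b : ℝ) : Set ℝ := {t | ∃ k : ℤ, k ≤ 0 ∧ xc a b (eig a b ^ k * t) = 0}

theorem glu_subset_bas : glu a b ⊆ bas a b := fun t ht => ⟨0, le_rfl, by simpa using ht.1⟩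

theorem zpow_mul_zpow_mul (h : (a, b) ∈ S) (m n : ℤ) (t : ℝ) :
    eig a b ^ m * (eig a b ^ n * t) = eig a b ^ (m + n) * t := by
  rw [zpow_add₀ (eig_ne h), mul_assoc]

theorem zpow_mul_mem_bas (h : (a, b) ∈ S) {t : ℝ} (ht : t ∈ bas a b) {n : ℤ} (hn : 0 ≤ n) :
    eig a b ^ n * t ∈ bas a b := by
  obtain ⟨k, hk, hx⟩ := ht
  exact ⟨k - n, by omega, by rw [zpow_mul_zpow_mul h, sub_add_cancel]; exact hx⟩

theorem eig_mul_mem_bas (h : (a, b) ∈ S) {t : ℝ} (ht : t ∈ bas a b) : eig a b * t ∈ bas a b := by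
  simpa using zpow_mul_mem_bas h ht zero_le_one

/-- The far past lies in the right half-plane, so there is a first visit to the axis, and that visit
is a gluing point. -/
theorem exists_glu_of_mem_bas (h : (a, b) ∈ S) {t : ℝ} (ht : t ∈ bas a b) :
    ∃ g ∈ glu a b, ∃ n : ℤ, 0 ≤ n ∧ t = eig a b ^ n * g := by
  obtain ⟨N, hN⟩ := exists_zpow_small h |t|
  obtain ⟨k, hk0, hk⟩ := ht
  obtain ⟨m, hm, hmin⟩ := Int.exists_least_of_bdd (P := fun m => xc a b (eig a b ^ m * t) = 0)
    ⟨N, fun m hm => by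
      by_contra hlt
      exact (xc_pos_of_small h (hN m (by omega) t le_rfl)).ne' hm⟩ ⟨k, hk⟩
  have hmk := hmin k hk
  refine ⟨eig a b ^ m * t, ⟨hm, fun j hj => ?_⟩, -m, by omega, ?_⟩
  · rw [zpow_mul_zpow_mul h]
    exact fun e => absurd (hmin _ e) (by omega)
  · rw [zpow_mul_zpow_mul h]; simp

theorem not_mem_glu_iff (h : (a, b) ∈ S) {t : ℝ} (ht : t ∈ bas a b) :
    t ∉ glu a b ↔ ∃ u ∈ bas a b, t = eig a b * u := by
  constructor
  · intro hn
    obtain ⟨g, hg, n, hn0, rfl⟩ := exists_glu_of_mem_bas h ht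
    have hn1 : n ≠ 0 := by rintro rfl; exact hn (by simpa using hg)
    refine ⟨eig a b ^ (n - 1) * g, zpow_mul_mem_bas h (glu_subset_bas hg) (by omega), ?_⟩
    rw [← eig_zpow_succ h, sub_add_cancel]
  · rintro ⟨u, ⟨k, hk, hx⟩, rfl⟩ hg
    refine hg.2 (k - 1) (by omega) ?_
    rw [mul_left_comm, ← eig_zpow_succ h, sub_add_cancel]
    exact hx

/-- The time of the first visit to the axis is an invariant of the orbit. -/
theorem glu_unique (h : (a, b) ∈ S) {g g' : ℝ} (hg : g ∈ glu a b) (hg' : g' ∈ glu a b) {m n : ℤ}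
    (e : eig a b ^ m * g = eig a b ^ n * g') : m = n ∧ g = g' := by
  have key : ∀ {g g' : ℝ}, g ∈ glu a b → g' ∈ glu a b → ∀ {m n : ℤ},
      eig a b ^ m * g = eig a b ^ n * g' → ¬ m < n := by
    intro g g' hg hg' m n e hlt
    refine hg.2 (m - n) (by omega) ?_
    have : eig a b ^ (m - n) * g = g' := by
      rw [show m - n = -n + m by ring, ← zpow_mul_zpow_mul h, e, zpow_mul_zpow_mul h]; simp
    rw [this]; exact hg'.1
  have hmn : m = n := le_antisymm (not_lt.1 (key hg' hg e.symm)) (not_lt.1 (key hg hg' e))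
  subst hmn
  exact ⟨rfl, mul_left_cancel₀ (zpow_ne_zero _ (eig_ne h)) e⟩

theorem tendsto_mul_punctured {c : ℝ} (hc : c ≠ 0) (t : ℝ) :
    Tendsto (fun s => c * s) (𝓝[≠] t) (𝓝[≠] (c * t)) := by
  refine tendsto_nhdsWithin_of_tendsto_nhds_of_eventually_within _ ?_ ?_
  · exact ((continuous_const_mul c).tendsto t).mono_left nhdsWithin_le_nhds
  · filter_upwards [self_mem_nhdsWithin] with s hs
    exact fun e => hs (mul_left_cancel₀ hc e)

theorem eventually_sign (h : (a, b) ∈ S) {t : ℝ} {k : ℤ} {q : ℤˣ}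
    (hq : 0 < ((q : ℤ) : ℝ) * xc a b (eig a b ^ k * t)) :
    ∀ᶠ s in 𝓝 t, 0 < ((q : ℤ) : ℝ) * xc a b (eig a b ^ k * s) := by
  have hc : Continuous fun s => ((q : ℤ) : ℝ) * xc a b (eig a b ^ k * s) :=
    continuous_const.mul ((continuous_xc h).comp (continuous_const_mul _))
  exact (hc.tendsto t).eventually (lt_mem_nhds hq)

/-- Near a gluing point, the signs in the past are constant. -/
theorem glu_past_signs (h : (a, b) ∈ S) {g : ℝ} (hg : g ∈ glu a b) :
    ∃ p : ℤ → ℤˣ, ∀ᶠ s in 𝓝 g, ∀ k < 0, 0 < ((p k : ℤ) : ℝ) * xc a b (eig a b ^ k * s) := by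
  have hex : ∀ k : ℤ, ∃ q : ℤˣ, k < 0 → 0 < ((q : ℤ) : ℝ) * xc a b (eig a b ^ k * g) := by
    intro k
    by_cases hk : k < 0
    · obtain ⟨q, hq⟩ := exists_units_mul_pos (hg.2 k hk)
      exact ⟨q, fun _ => hq⟩
    · exact ⟨1, fun h => absurd h hk⟩
  choose p hp using hex
  refine ⟨p, ?_⟩
  obtain ⟨N, hN⟩ := exists_zpow_small h (|g| + 1)
  have h1 : ∀ᶠ s in 𝓝 g, |s| ≤ |g| + 1 :=
    ((continuous_abs.tendsto g).eventually (gt_mem_nhds (by linarith))).mono fun s hs => hs.le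
  -- Up to time `N` all points near `g` are in the right half-plane, so only finitely many times
  -- need continuity.
  have h2 : ∀ᶠ s in 𝓝 g, ∀ k ∈ Finset.Ioo N 0,
      0 < ((p k : ℤ) : ℝ) * xc a b (eig a b ^ k * s) := by
    rw [Finset.eventually_all]
    intro k hk
    exact eventually_sign h (hp k (Finset.mem_Ioo.1 hk).2)
  filter_upwards [h1, h2] with s hs1 hs2 k hk
  by_cases hkN : k ≤ N
  · have e1 := xc_pos_of_small h (hN k hkN s hs1)
    have e2 := xc_pos_of_small h (hN k hkN g (by linarith))
    have e3 : 1 = p k := units_eq_of_mul_pos (hp k hk) (by simpa using e2.le)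
    rw [← e3]; simpa using e1
  · exact hs2 k (Finset.mem_Ioo.2 ⟨by omega, hk⟩)

/-- The manifold crosses the vertical axis at a gluing point. -/
theorem glu_cross (h : (a, b) ∈ S) {g : ℝ} (hg : g ∈ glu a b) :
    ∃ ε > 0, ∀ u v, |u - g| < ε → |v - g| < ε → u < g → g < v → xc a b u * xc a b v < 0 := by
  obtain ⟨p, hp⟩ := glu_past_signs h hg
  have hpg := hp.self_of_nhds
  obtain ⟨ε, hε, hball⟩ := Metric.eventually_nhds_iff.1 hp
  refine ⟨ε, hε, fun u v hu hv hug hgv => ?_⟩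
  have key := sign_agree h h hug.ne' hgv.ne p 0 (fun k hk => (hpg k hk).le)
    (fun k hk => (hball (y := u) hu k hk).le) (fun k hk => (hpg k hk).le)
    (fun k hk => (hball (y := v) hv k hk).le)
  simp only [zpow_zero, one_mul, hg.1, sub_zero] at key
  have h1 : 0 < (g - u) * (v - g) := mul_pos (by linarith) (by linarith)
  nlinarith

theorem glu_cone (h : (a, b) ∈ S) {g : ℝ} (hg : g ∈ glu a b) :
    ∀ᶠ s in 𝓝[≠] g, Cone a (param a b s - param a b g) := by
  obtain ⟨p, hp⟩ := glu_past_signs h hg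
  have hpg := hp.self_of_nhds
  filter_upwards [nhdsWithin_le_nhds hp, self_mem_nhdsWithin] with s hs hsg
  simpa using cone_of_agree h (Ne.symm hsg) p 0 (fun k hk => (hpg k hk).le)
    (fun k hk => (hs k hk).le)

/-- The images of a gluing point are local extrema of the first coordinate. -/
theorem glu_image_extremum (h : (a, b) ∈ S) {g : ℝ} (hg : g ∈ glu a b) {n : ℤ} (hn : 1 ≤ n) :
    ∃ q : ℤˣ, ∀ᶠ s in 𝓝[≠] g,
      0 < ((q : ℤ) : ℝ) * (xc a b (eig a b ^ n * s) - xc a b (eig a b ^ n * g)) ∧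
      Cone a (param a b (eig a b ^ n * s) - param a b (eig a b ^ n * g)) := by
  induction n, hn using Int.leInduction with
  | base =>
    -- Both branches fold towards the left, so a turning point is a local maximum of the first
    -- coordinate.
    refine ⟨-1, ?_⟩
    filter_upwards [glu_cone h hg] with s hs
    have hx : xc a b s ≠ 0 := by
      have := hs.1
      change xc a b s - xc a b g ≠ 0 at this
      rwa [hg.1, sub_zero] at this
    obtain ⟨q, hq⟩ := exists_units_mul_pos hx
    have := cone_step h q (show 0 ≤ ((q : ℤ) : ℝ) * xc a b g by rw [hg.1, mul_zero]) hq.le hs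
    rw [L_param h, L_param h] at this
    rw [zpow_one]
    refine ⟨?_, this.1⟩
    have h2 := this.2.2
    change (xc a b _ - xc a b _) * (_ * (xc a b s - xc a b g)) < 0 at h2
    rw [hg.1, sub_zero] at h2
    simp only [Units.val_neg, Units.val_one, Int.cast_neg, Int.cast_one, neg_mul, one_mul]
    nlinarith
  | succ n hn ih =>
    obtain ⟨q, hq⟩ := ih
    have hr : ∃ r : ℤˣ, 0 ≤ ((r : ℤ) : ℝ) * xc a b (eig a b ^ n * g) ∧
        ∀ᶠ s in 𝓝[≠] g, 0 < ((r : ℤ) : ℝ) * xc a b (eig a b ^ n * s) := by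
      by_cases hx : xc a b (eig a b ^ n * g) = 0
      · refine ⟨q, by rw [hx, mul_zero], hq.mono fun s hs => ?_⟩
        rw [hx, sub_zero] at hs
        exact hs.1
      · obtain ⟨r, hr⟩ := exists_units_mul_pos hx
        exact ⟨r, hr.le, nhdsWithin_le_nhds (eventually_sign h hr)⟩
    obtain ⟨r, hr0, hr⟩ := hr
    -- Near the image the orbit stays on the side `r` of the axis, and that branch multiplies the
    -- sign of the difference by `-r`.
    refine ⟨-(r * q), ?_⟩
    filter_upwards [hq, hr] with s hs hrs
    have := cone_step h r hr0 hrs.le hs.2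
    rw [L_param h, L_param h, ← eig_zpow_succ h, ← eig_zpow_succ h] at this
    refine ⟨?_, this.1⟩
    have h2 := this.2.2
    change (xc a b _ - xc a b _) * (_ * (xc a b _ - xc a b _)) < 0 at h2
    have h3 := hs.1
    generalize xc a b (eig a b ^ (n + 1) * s) - xc a b (eig a b ^ (n + 1) * g) = A at *
    generalize xc a b (eig a b ^ n * s) - xc a b (eig a b ^ n * g) = B at *
    rcases Int.units_eq_one_or r with rfl | rfl <;>
      rcases Int.units_eq_one_or q with rfl | rfl <;> simp at * <;> nlinarith

/-- Near the image of a gluing point, the first coordinate has a constant sign. -/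
theorem glu_image_sign (h : (a, b) ∈ S) {g : ℝ} (hg : g ∈ glu a b) {n : ℤ} (hn : 1 ≤ n) :
    ∃ q : ℤˣ, ∀ᶠ s in 𝓝[≠] g, 0 < ((q : ℤ) : ℝ) * xc a b (eig a b ^ n * s) := by
  obtain ⟨q, hq⟩ := glu_image_extremum h hg hn
  by_cases hx : xc a b (eig a b ^ n * g) = 0
  · refine ⟨q, hq.mono fun s hs => ?_⟩
    rw [hx, sub_zero] at hs
    exact hs.1
  · obtain ⟨r, hr⟩ := exists_units_mul_pos hx
    exact ⟨r, nhdsWithin_le_nhds (eventually_sign h hr)⟩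

theorem eventually_scale (h : (a, b) ∈ S) {n : ℤ} {t : ℝ} {P : ℝ → Prop} :
    (∀ᶠ s in 𝓝[≠] (eig a b ^ n * t), P s) ↔ ∀ᶠ s in 𝓝[≠] t, P (eig a b ^ n * s) := by
  constructor
  · exact fun hP => (tendsto_mul_punctured (zpow_ne_zero n (eig_ne h)) t).eventually hP
  · intro hP
    have := tendsto_mul_punctured (zpow_ne_zero (-n) (eig_ne h)) (eig a b ^ n * t)
    rw [zpow_mul_zpow_mul h] at this
    simp only [neg_add_cancel, zpow_zero, one_mul] at this
    refine (this.eventually hP).mono fun s hs => ?_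
    rw [zpow_mul_zpow_mul h] at hs
    simpa using hs

/-- The first coordinate does not change its sign at basic points that are not gluing points. -/
theorem sign_of_not_mem_glu (h : (a, b) ∈ S) {t : ℝ} (ht : t ∈ bas a b) (hn : t ∉ glu a b) :
    ∃ q : ℤˣ, ∀ᶠ s in 𝓝[≠] t, 0 < ((q : ℤ) : ℝ) * xc a b s := by
  obtain ⟨g, hg, n, hn0, rfl⟩ := exists_glu_of_mem_bas h ht
  have hn1 : n ≠ 0 := by rintro rfl; exact hn (by simpa using hg)
  obtain ⟨q, hq⟩ := glu_image_sign h hg (show 1 ≤ n by omega)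
  exact ⟨q, (eventually_scale h).2 hq⟩

theorem zero_isolated (h : (a, b) ∈ S) {t : ℝ} (ht : xc a b t = 0) :
    ∀ᶠ s in 𝓝[≠] t, xc a b s ≠ 0 := by
  by_cases hg : t ∈ glu a b
  · filter_upwards [glu_cone h hg] with s hs
    have := hs.1
    change xc a b s - xc a b t ≠ 0 at this
    rwa [ht, sub_zero] at this
  · obtain ⟨q, hq⟩ := sign_of_not_mem_glu h ⟨0, le_rfl, by simpa using ht⟩ hg
    exact hq.mono fun s hs e => by rw [e, mul_zero] at hs; exact lt_irrefl _ hs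

theorem zeros_finite (h : (a, b) ∈ S) (M : ℝ) :
    ({t | xc a b t = 0} ∩ Set.Icc (-M) M).Finite := by
  by_contra hinf
  obtain ⟨t, -, hacc⟩ := Set.Infinite.exists_accPt_of_subset_isCompact hinf isCompact_Icc
    Set.inter_subset_right
  have hfr := accPt_iff_frequently_nhdsNE.1 hacc
  have ht : xc a b t = 0 := by
    have hcl : IsClosed {t | xc a b t = 0} := isClosed_eq (continuous_xc h) continuous_const
    refine hcl.closure_subset (mem_closure_iff_frequently.2 ?_)
    exact (hfr.filter_mono nhdsWithin_le_nhds).mono fun s hs => hs.1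
  obtain ⟨s, hs1, hs2⟩ := (hfr.and_eventually (zero_isolated h ht)).exists
  exact hs2 hs1.1

theorem abs_zpow_mul_le (h : (a, b) ∈ S) {k : ℤ} (hk : k ≤ 0) (t : ℝ) :
    |eig a b ^ k * t| ≤ |t| := by
  have h3 := eig_lt h
  rw [abs_mul, abs_zpow]
  refine mul_le_of_le_one_left (abs_nonneg _) (zpow_le_one_of_nonpos₀ ?_ hk)
  rw [abs_of_neg (by linarith)]; linarith

/-- On a bounded set only the times in `[N, 0]` can meet the axis, and each of them contributes
finitely many zeros. -/
theorem bas_finite (h : (a, b) ∈ S) (M : ℝ) : (bas a b ∩ Set.Icc (-M) M).Finite := by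
  obtain ⟨N, hN⟩ := exists_zpow_small h M
  refine ((Finset.Icc N 0).finite_toSet.biUnion
    (t := fun k => (fun t => eig a b ^ k * t) ⁻¹' ({t | xc a b t = 0} ∩ Set.Icc (-M) M))
    fun k _ => (zeros_finite h M).preimage
      (mul_right_injective₀ (zpow_ne_zero k (eig_ne h))).injOn).subset ?_
  rintro t ⟨⟨k, hk, hx⟩, ht⟩
  have ht' := abs_le.2 ht
  simp only [Set.mem_iUnion, Set.mem_preimage]
  refine ⟨k, ?_, hx, abs_le.1 ((abs_zpow_mul_le h hk t).trans ht')⟩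
  simp only [Finset.coe_Icc, Set.mem_Icc]
  refine ⟨?_, hk⟩
  by_contra hlt
  exact (xc_pos_of_small h (hN k (by omega) t ht')).ne' hx

/-- The parameter of `L⁻¹(Z)`. -/
noncomputable def e0 (a b : ℝ) : ℝ := -(1 / (1 + a - b))

theorem e0_neg (h : (a, b) ∈ S) : e0 a b < 0 := by
  have := (S_bounds h).2.2.2
  unfold e0
  rw [neg_lt_zero]; positivity

theorem localPt_linear (h : (a, b) ∈ S) {s : ℝ} (hs : 0 ≤ 1 / (1 + a - b) + s) :
    L a b (localPt a b s) = localPt a b (eig a b * s) := by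
  have h2 := eig_sq h
  obtain ⟨-, -, -, hD⟩ := S_bounds h
  have hne := eig_ne h
  unfold L localPt
  simp only [abs_of_nonneg hs, Prod.mk.injEq]
  constructor
  · field_simp
    linear_combination (-s * (1 + a - b)) * h2
  · field_simp

/-- One application of `L` to the local segment stays straight, which lengthens the segment by the
factor `|eig a b|`. -/
theorem param_local (h : (a, b) ∈ S) {t : ℝ} (ht : |t| ≤ -(eig a b) * (1 / (1 + a - b))) :
    param a b t = localPt a b t := by
  have h3 := eig_lt h
  have hs : |t / eig a b| ≤ 1 / (1 + a - b) := by
    rw [abs_div, abs_of_neg (show eig a b < 0 by linarith), div_le_iff₀ (by linarith)]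
    linarith
  have e : eig a b * (t / eig a b) = t := by have := eig_ne h; field_simp
  rw [← e, ← L_param h, param_eq_localPt h hs, L_localPt h hs]

/-- Division by the eigenvalue maps this interval around 0 into itself, and the first coordinate is
positive on it, so no past image meets the axis. -/
theorem not_mem_bas_near (h : (a, b) ∈ S) {t : ℝ} (h1 : e0 a b < t)
    (h2 : t < eig a b * e0 a b) : t ∉ bas a b := by
  have h3 := eig_lt h
  have h0 := e0_neg h
  have hpos : ∀ t, e0 a b < t → t < eig a b * e0 a b → 0 < xc a b t := by
    intro t h1 h2
    unfold e0 at *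
    rw [xc, param_local h (abs_le.2 ⟨by nlinarith, by linarith⟩)]
    simp only [localPt]; linarith
  have hstep : ∀ (n : ℕ) t, e0 a b < t → t < eig a b * e0 a b →
      e0 a b < eig a b ^ (-(n : ℤ)) * t ∧ eig a b ^ (-(n : ℤ)) * t < eig a b * e0 a b := by
    intro n
    induction n with
    | zero => intro t h1 h2; simpa using ⟨h1, h2⟩
    | succ n ih =>
      intro t h1 h2
      have e : eig a b ^ (-((n + 1 : ℕ) : ℤ)) * t = eig a b ^ (-(n : ℤ)) * (t / eig a b) := by
        rw [show -((n + 1 : ℕ) : ℤ) = -(n : ℤ) + -1 by push_cast; ring,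
          zpow_add₀ (eig_ne h), zpow_neg_one]
        ring
      rw [e]
      have hneg : eig a b < 0 := by linarith
      refine ih _ ?_ ?_
      · rw [lt_div_iff_of_neg hneg]; linarith
      · rw [div_lt_iff_of_neg hneg]; nlinarith
  rintro ⟨k, hk, hx⟩
  obtain ⟨n, rfl⟩ := Int.exists_eq_neg_ofNat hk
  exact (hpos _ (hstep n t h1 h2).1 (hstep n t h1 h2).2).ne' hx

/-- Dividing once by the eigenvalue leads into the interval of `not_mem_bas_near`, so only time 0 is
left; there the curve is still straight and already to the left of the axis. -/
theorem not_mem_bas_left (h : (a, b) ∈ S) {t : ℝ} (h1 : eig a b * (eig a b * e0 a b) < t)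
    (h2 : t < e0 a b) : t ∉ bas a b := by
  have h3 := eig_lt h
  have h0 := e0_neg h
  have hneg : eig a b < 0 := by linarith
  have e : eig a b * (t / eig a b) = t := by have := eig_ne h; field_simp
  have s1 : 0 < t / eig a b := div_pos_of_neg_of_neg (by linarith) hneg
  have s2 : t / eig a b < eig a b * e0 a b := by
    rw [div_lt_iff_of_neg hneg]; linarith
  rintro ⟨k, hk, hx⟩
  rcases hk.lt_or_eq with hk | rfl
  · refine not_mem_bas_near h (t := t / eig a b) (by linarith) s2 ⟨k + 1, by omega, ?_⟩
    rw [eig_zpow_succ h, mul_left_comm, e]; exact hx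
  · rw [zpow_zero, one_mul, xc, ← e, ← L_param h, param_local h, localPt_linear h, e] at hx
    · simp only [localPt] at hx
      unfold e0 at h2; linarith
    · unfold e0 at h0; linarith
    · rw [abs_of_pos s1]; unfold e0 at s2; linarith

theorem e0_mem_glu (h : (a, b) ∈ S) : e0 a b ∈ glu a b := by
  have h0 := e0_neg h
  have h3 := eig_lt h
  have hx : xc a b (e0 a b) = 0 := by
    rw [xc_eq h]
    · unfold e0; ring
    · rw [abs_of_neg h0]; unfold e0; linarith
  refine ⟨hx, fun k hk hk0 => ?_⟩
  have e : eig a b ^ k * e0 a b = eig a b ^ (k + 1) * (e0 a b / eig a b) := by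
    rw [zpow_add_one₀ (eig_ne h)]; have := eig_ne h; field_simp
  have s1 : 0 < e0 a b / eig a b := div_pos_of_neg_of_neg h0 (by linarith)
  have s2 : e0 a b / eig a b < eig a b * e0 a b := by
    rw [div_lt_iff_of_neg (by linarith)]
    have : 0 < -e0 a b * (eig a b ^ 2 - 1) := mul_pos (by linarith) (by nlinarith)
    linear_combination this
  rw [e] at hk0
  exact not_mem_bas_near h (by linarith) s2 ⟨k + 1, by omega, hk0⟩

theorem bas_unbounded (h : (a, b) ∈ S) (M : ℝ) :
    (∃ t ∈ bas a b, M < t) ∧ ∃ t ∈ bas a b, t < M := by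
  have h0 := e0_neg h
  have h3 := eig_lt h
  have hb := glu_subset_bas (e0_mem_glu h)
  obtain ⟨n, hn⟩ := pow_unbounded_of_one_lt (|M| / -e0 a b)
    (show 1 < eig a b ^ 2 by nlinarith)
  rw [div_lt_iff₀ (by linarith)] at hn
  have e : (eig a b ^ 2) ^ n = eig a b ^ ((2 * n : ℕ) : ℤ) := by
    rw [zpow_natCast, pow_mul]
  have m := zpow_mul_mem_bas h hb (n := ((2 * n : ℕ) : ℤ)) (by positivity)
  rw [← e] at m
  have hM := le_abs_self M
  have hM' := neg_abs_le M
  refine ⟨⟨_, eig_mul_mem_bas h m, ?_⟩, _, m, by linarith⟩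
  nlinarith [abs_nonneg M]

end BasicParameters

/-! ### Order-preserving enumerations by the integers -/

section IntOrder

/-- Surjectivity rules out jumps, so successors go to successors. -/
theorem strictMono_int_eq_id {f : ℤ → ℤ} (hf : StrictMono f) (hs : Function.Surjective f)
    (h0 : f 0 = 0) : f = id := by
  have hsucc : ∀ i, f (i + 1) = f i + 1 := by
    intro i
    obtain ⟨j, hj⟩ := hs (f i + 1)
    have h1 : i < j := hf.lt_iff_lt.1 (by omega)
    have h2 : f i < f (i + 1) := hf (by omega)
    have h3 : f (i + 1) ≤ f j := hf.monotone (by omega)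
    omega
  funext i
  induction i using Int.induction_on with
  | zero => exact h0
  | succ i ih => rw [hsucc, ih]; rfl
  | pred i ih =>
    have := hsucc (-(i : ℤ) - 1)
    rw [sub_add_cancel, ih] at this
    simp only [id] at this ⊢
    omega

theorem strictMono_eq_of_range_eq {α : Type*} [LinearOrder α] {e e' : ℤ → α} (he : StrictMono e)
    (he' : StrictMono e') (hr : Set.range e = Set.range e') (h0 : e 0 = e' 0) : e = e' := by
  have hex : ∀ i, ∃ j, e j = e' i := fun i => by
    have : e' i ∈ Set.range e := hr ▸ Set.mem_range_self i
    exact this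
  choose f hf using hex
  have hmono : StrictMono f := fun i j hij => he.lt_iff_lt.1 (by rw [hf, hf]; exact he' hij)
  have hsurj : Function.Surjective f := fun j => by
    have : e j ∈ Set.range e' := hr ▸ Set.mem_range_self j
    obtain ⟨i, hi⟩ := this
    exact ⟨i, he.injective (by rw [hf, hi])⟩
  have := strictMono_int_eq_id hmono hsurj (he.injective (by rw [hf, h0]))
  funext i
  rw [← hf, this, id]

theorem strictAnti_eq_of_range_eq {e e' : ℤ → ℤ} (he : StrictAnti e)
    (he' : StrictAnti e') (hr : Set.range e = Set.range e') (h0 : e 0 = e' 0) : e = e' := by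
  have := strictMono_eq_of_range_eq (e := fun i => OrderDual.toDual (e i))
    (e' := fun i => OrderDual.toDual (e' i)) (fun i j hij => he hij) (fun i j hij => he' hij)
    (by
      change Set.range (OrderDual.toDual ∘ e) = Set.range (OrderDual.toDual ∘ e')
      rw [Set.range_comp, Set.range_comp, hr]) (congrArg _ h0)
  exact funext fun i => congrArg OrderDual.ofDual (congrFun this i)

/-- A locally finite subset of the real line that is unbounded in both directions can be
enumerated increasingly by the integers. -/
theorem exists_int_enumeration {B : Set ℝ} (hfin : ∀ M, (B ∩ Set.Icc (-M) M).Finite)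
    (hunb : ∀ M, (∃ t ∈ B, M < t) ∧ ∃ t ∈ B, t < M) {c : ℝ} (hc : c ∈ B) :
    ∃ e : ℤ → ℝ, StrictMono e ∧ Set.range e = B ∧ e 0 = c := by
  have hIcc : ∀ s t : B, (Set.Icc s t).Finite := by
    intro s t
    have : (Set.Icc s t) ⊆ Subtype.val ⁻¹'
        (B ∩ Set.Icc (-max |(s : ℝ)| |(t : ℝ)|) (max |(s : ℝ)| |(t : ℝ)|)) := by
      rintro u ⟨h1, h2⟩
      have h1 : (s : ℝ) ≤ u := h1
      have h2 : (u : ℝ) ≤ t := h2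
      refine ⟨u.2, ?_, ?_⟩
      · linarith [neg_abs_le (s : ℝ), le_max_left |(s : ℝ)| |(t : ℝ)|]
      · linarith [le_abs_self (t : ℝ), le_max_right |(s : ℝ)| |(t : ℝ)|]
    exact ((hfin _).preimage Subtype.val_injective.injOn).subset this
  let _ : LocallyFiniteOrder B := LocallyFiniteOrder.ofFiniteIcc hIcc
  let _ : SuccOrder B := LinearLocallyFiniteOrder.succOrder B
  let _ : PredOrder B := LinearLocallyFiniteOrder.predOrder B
  have : NoMaxOrder B := ⟨fun s => by
    obtain ⟨t, ht, hst⟩ := (hunb s).1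
    exact ⟨⟨t, ht⟩, hst⟩⟩
  have : NoMinOrder B := ⟨fun s => by
    obtain ⟨t, ht, hst⟩ := (hunb s).2
    exact ⟨⟨t, ht⟩, hst⟩⟩
  have : Nonempty B := ⟨⟨c, hc⟩⟩
  let φ : B ≃o ℤ := orderIsoIntOfLinearSuccPredArch
  refine ⟨fun i => (φ.symm (i + φ ⟨c, hc⟩) : B), fun i j hij => ?_, ?_, by simp⟩
  · have : φ.symm (i + φ ⟨c, hc⟩) < φ.symm (j + φ ⟨c, hc⟩) :=
      φ.symm.strictMono (by omega)
    exact this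
  · ext t
    constructor
    · rintro ⟨i, rfl⟩
      exact Subtype.coe_prop _
    · intro ht
      exact ⟨φ ⟨t, ht⟩ - φ ⟨c, hc⟩, by simp⟩

end IntOrder

/-! ### The enumeration of basic points and the induced index map -/

section Enumeration

variable {a b : ℝ}

theorem mem_gluingPts (h : (a, b) ∈ S) {t : ℝ} : param a b t ∈ gluingPts a b ↔ t ∈ glu a b := by
  constructor
  · rintro ⟨-, h1, h2⟩
    refine ⟨h1, fun k hk => ?_⟩
    have := h2 (-k).toNat (by omega)
    rw [Linv_iterate_param h, Int.toNat_of_nonneg (by omega), neg_neg] at this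
    exact this
  · rintro ⟨h1, h2⟩
    refine ⟨range_param h ▸ Set.mem_range_self t, h1, fun k hk => ?_⟩
    rw [Linv_iterate_param h]
    exact h2 _ (by omega)

theorem gluingPts_eq (h : (a, b) ∈ S) : gluingPts a b = param a b '' glu a b := by
  ext P
  constructor
  · intro hP
    obtain ⟨t, rfl⟩ : P ∈ Set.range (param a b) := range_param h ▸ hP.1
    exact ⟨t, (mem_gluingPts h).1 hP, rfl⟩
  · rintro ⟨t, ht, rfl⟩
    exact (mem_gluingPts h).2 ht

theorem mem_turningPts (h : (a, b) ∈ S) {P : ℝ × ℝ} :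
    P ∈ turningPts a b ↔ ∃ g ∈ glu a b, param a b (eig a b * g) = P := by
  unfold turningPts
  rw [gluingPts_eq h, Set.image_image]
  simp only [L_param h, Set.mem_image]

theorem basicPts_eq (h : (a, b) ∈ S) : basicPts a b = param a b '' bas a b := by
  ext P
  unfold basicPts postturningPts
  constructor
  · rintro ((hP | hP) | ⟨T, hT, j, -, rfl⟩)
    · rw [gluingPts_eq h] at hP
      exact Set.image_mono glu_subset_bas hP
    · obtain ⟨g, hg, rfl⟩ := (mem_turningPts h).1 hP
      exact ⟨_, eig_mul_mem_bas h (glu_subset_bas hg), rfl⟩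
    · obtain ⟨g, hg, rfl⟩ := (mem_turningPts h).1 hT
      rw [L_iterate_param h]
      exact ⟨_, zpow_mul_mem_bas h (eig_mul_mem_bas h (glu_subset_bas hg)) (by omega), rfl⟩
  · rintro ⟨t, ht, rfl⟩
    obtain ⟨g, hg, n, hn, rfl⟩ := exists_glu_of_mem_bas h ht
    rcases hn.eq_or_lt with rfl | hn
    · left; left
      simpa using (mem_gluingPts h).2 hg
    · rcases (show 1 ≤ n by omega).eq_or_lt with rfl | hn
      · left; right
        exact (mem_turningPts h).2 ⟨g, hg, by rw [zpow_one]⟩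
      · right
        refine ⟨_, (mem_turningPts h).2 ⟨g, hg, rfl⟩, (n - 1).toNat, by omega, ?_⟩
        rw [L_iterate_param h, Int.toNat_of_nonneg (by omega), mul_left_comm, ← eig_zpow_succ h,
          sub_add_cancel]

/-- `Z` is the point of the straight segment with parameter `eig a b * e0 a b`, where the second
coordinate vanishes. -/
theorem Linv_Z (h : (a, b) ∈ S) : Linv a b (Z a b) = param a b (e0 a b) := by
  have h0 := e0_neg h
  have h3 := eig_lt h
  have hne := eig_ne h
  have hD := (S_bounds h).2.2.2
  have hZ : Z a b = param a b (eig a b * e0 a b) := by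
    rw [param_local h]
    · unfold localPt
      refine Prod.ext ?_ ?_
      · simp only [Z, e0, eig]
        field_simp
        ring
      · simp only [Z, e0]
        field_simp
        ring
    · rw [abs_of_pos (mul_pos_of_neg_of_neg (by linarith) h0)]
      unfold e0; linarith
  rw [hZ, Linv_param h]
  congr 1
  field_simp

/-- An increasing enumeration of the parameters of the basic points, together with the map that
the Lozi map induces on the indices. -/
structure BasicEnum (a b : ℝ) (e : ℤ → ℝ) (σ : ℤ → ℤ) : Prop where
  strictMono : StrictMono e
  range_eq : Set.range e = bas a b
  zero : e 0 = e0 a b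
  eig_mul : ∀ i, eig a b * e i = e (σ i)

theorem exists_basicEnum (h : (a, b) ∈ S) : ∃ e σ, BasicEnum a b e σ := by
  obtain ⟨e, he, hr, h0⟩ := exists_int_enumeration (bas_finite h) (bas_unbounded h)
    (glu_subset_bas (e0_mem_glu h))
  have hex : ∀ i, ∃ j, eig a b * e i = e j := fun i => by
    have hi : e i ∈ bas a b := hr ▸ Set.mem_range_self i
    have : eig a b * e i ∈ Set.range e := hr ▸ eig_mul_mem_bas h hi
    obtain ⟨j, hj⟩ := this
    exact ⟨j, hj.symm⟩
  choose σ hσ using hex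
  exact ⟨e, σ, he, hr, h0, hσ⟩

theorem before_param (h : (a, b) ∈ S) {s t : ℝ} :
    Before a b (param a b s) (param a b t) ↔ s < t := by
  constructor
  · rintro ⟨u, v, huv, hu, hv⟩
    rwa [← param_injective h hu, ← param_injective h hv]
  · exact fun hst => ⟨s, t, hst, rfl, rfl⟩

namespace BasicEnum

variable {e : ℤ → ℝ} {σ : ℤ → ℤ}

theorem mem_bas (H : BasicEnum a b e σ) (i : ℤ) : e i ∈ bas a b :=
  H.range_eq ▸ Set.mem_range_self i

theorem exists_eq (H : BasicEnum a b e σ) {t : ℝ} (ht : t ∈ bas a b) : ∃ i, e i = t := by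
  rwa [← H.range_eq] at ht

/-- This gives both the uniqueness of the enumeration and the value of `E`, which is defined by
choice. -/
theorem isBasicEnum_iff (h : (a, b) ∈ S) (H : BasicEnum a b e σ) (F : ℤ → ℝ × ℝ) :
    IsBasicEnum a b F ↔ F = fun i => param a b (e i) := by
  constructor
  · rintro ⟨h1, h2, h3⟩
    have hex : ∀ i, ∃ t ∈ bas a b, param a b t = F i := fun i => by
      have : F i ∈ basicPts a b := h2 ▸ Set.mem_range_self i
      rwa [basicPts_eq h] at this
    choose f hf hF using hex
    have hf0 : f 0 = e 0 := param_injective h (by rw [hF, h3, Linv_Z h, H.zero])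
    have hfm : StrictMono f := fun i j hij => by
      have := h1 i j hij
      rwa [← hF, ← hF, before_param h] at this
    have hfr : Set.range f = Set.range e := by
      rw [H.range_eq]
      ext t
      constructor
      · rintro ⟨i, rfl⟩
        exact hf i
      · intro ht
        have : param a b t ∈ Set.range F := by
          rw [h2, basicPts_eq h]; exact ⟨t, ht, rfl⟩
        obtain ⟨i, hi⟩ := this
        exact ⟨i, param_injective h (by rw [hF, hi])⟩
    rw [← strictMono_eq_of_range_eq hfm H.strictMono hfr hf0]
    exact funext fun i => (hF i).symm
  · rintro rfl
    refine ⟨fun i j hij => (before_param h).2 (H.strictMono hij), ?_, ?_⟩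
    · rw [basicPts_eq h, ← H.range_eq, ← Set.range_comp]; rfl
    · simp only [Linv_Z h, H.zero]

theorem E_eq (h : (a, b) ∈ S) (H : BasicEnum a b e σ) : E a b = fun i => param a b (e i) :=
  (H.isBasicEnum_iff h _).1 (Classical.epsilon_spec ⟨_, (H.isBasicEnum_iff h _).2 rfl⟩)

theorem strictAnti (h : (a, b) ∈ S) (H : BasicEnum a b e σ) : StrictAnti σ := by
  intro i j hij
  rw [← H.strictMono.lt_iff_lt, ← H.eig_mul, ← H.eig_mul]
  exact mul_lt_mul_of_neg_left (H.strictMono hij) (by linarith [eig_lt h])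

/-- By `not_mem_bas_near` no basic parameter lies between `e 0` and its image, so the image is the
next one. -/
theorem map_zero (h : (a, b) ∈ S) (H : BasicEnum a b e σ) : σ 0 = 1 := by
  have h0 := e0_neg h
  have h1 : e 0 < e (σ 0) := by
    rw [← H.eig_mul, H.zero]
    have := eig_lt h
    have := mul_pos_of_neg_of_neg (show eig a b < 0 by linarith) h0
    linarith
  have h2 := H.strictMono.lt_iff_lt.1 h1
  by_contra hne
  refine not_mem_bas_near h ?_ ?_ (H.mem_bas 1)
  · rw [← H.zero]; exact H.strictMono one_pos
  · rw [← H.zero, H.eig_mul]; exact H.strictMono (by omega)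

theorem map_one (h : (a, b) ∈ S) (H : BasicEnum a b e σ) : σ 1 = -1 := by
  have h2 := H.strictAnti h one_pos
  have e1 : eig a b * (eig a b * e0 a b) = e (σ 1) := by
    rw [← H.zero, H.eig_mul, H.map_zero h, H.eig_mul]
  have h0 := e0_neg h
  have h3 := eig_lt h
  have h1 : e (σ 1) < e 0 := by
    rw [← e1, H.zero]
    have : 0 < -e0 a b * (eig a b ^ 2 - 1) := mul_pos (by linarith) (by nlinarith)
    linear_combination this
  have h2 := H.strictMono.lt_iff_lt.1 h1
  by_contra hne
  refine not_mem_bas_left h ?_ ?_ (H.mem_bas (-1))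
  · rw [e1]; exact H.strictMono (by omega)
  · rw [← H.zero]; exact H.strictMono (by omega)

theorem not_mem_glu (h : (a, b) ∈ S) (H : BasicEnum a b e σ) (i : ℤ) :
    e i ∉ glu a b ↔ i ∈ Set.range σ := by
  rw [not_mem_glu_iff h (H.mem_bas i)]
  constructor
  · rintro ⟨u, hu, hi⟩
    obtain ⟨j, rfl⟩ := H.exists_eq hu
    exact ⟨j, H.strictMono.injective (by rw [hi, H.eig_mul])⟩
  · rintro ⟨j, rfl⟩
    exact ⟨e j, H.mem_bas j, (H.eig_mul j).symm⟩

theorem foldingPattern_eq (h : (a, b) ∈ S) (H : BasicEnum a b e σ) (i : ℤ) :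
    foldingPattern a b i = Letter.T ↔ i ∈ Set.range σ := by
  rw [← H.not_mem_glu h i, foldingPattern, H.E_eq h, mem_gluingPts h]
  split_ifs with hi <;> simp [hi]

/-- The eigenvalue is negative, so the image of the arc `i` runs from index `σ (i + 1)` to index `σ
i`. -/
theorem foldingTree_iff (h : (a, b) ∈ S) (H : BasicEnum a b e σ) (i j : ℤ) :
    foldingTree a b i j ↔ σ (i + 1) ≤ j ∧ j < σ i := by
  have harc : ∀ s t, arc a b (param a b s) (param a b t) = param a b '' Set.Icc s t := by
    intro s t
    ext W
    constructor
    · rintro ⟨s', u, t', h1, h2, h3, rfl, h5⟩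
      exact ⟨u, ⟨param_injective h h3 ▸ h1, param_injective h h5 ▸ h2⟩, rfl⟩
    · rintro ⟨u, ⟨h1, h2⟩, rfl⟩
      exact ⟨s, u, t, h1, h2, rfl, rfl, rfl⟩
  have hneg : eig a b < 0 := by linarith [eig_lt h]
  have himg : ∀ s t, L a b '' (param a b '' Set.Icc s t) =
      param a b '' Set.Icc (eig a b * t) (eig a b * s) := by
    intro s t
    rw [Set.image_image]
    simp only [L_param h]
    rw [← Set.image_image (param a b) (fun x => eig a b * x)]
    congr 1
    ext u
    constructor
    · rintro ⟨v, ⟨h1, h2⟩, rfl⟩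
      exact ⟨mul_le_mul_of_nonpos_left h2 hneg.le, mul_le_mul_of_nonpos_left h1 hneg.le⟩
    · rintro ⟨h1, h2⟩
      have e : eig a b * (u / eig a b) = u := by have := hneg.ne; field_simp
      refine ⟨u / eig a b, ⟨?_, ?_⟩, e⟩
      · rw [le_div_iff_of_neg hneg]; linarith
      · rw [div_le_iff_of_neg hneg]; linarith
  unfold foldingTree
  rw [H.E_eq h]
  simp only
  rw [harc, harc, himg, Set.image_subset_image_iff (param_injective h),
    Set.Icc_subset_Icc_iff (H.strictMono (lt_add_one j)).le, H.eig_mul, H.eig_mul,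
    H.strictMono.le_iff_le, H.strictMono.le_iff_le]
  omega

end BasicEnum

theorem existsUnique_isBasicEnum (h : (a, b) ∈ S) : ∃! F : ℤ → ℝ × ℝ, IsBasicEnum a b F := by
  obtain ⟨e, σ, H⟩ := exists_basicEnum h
  exact ⟨_, (H.isBasicEnum_iff h _).2 rfl, fun F hF => (H.isBasicEnum_iff h F).1 hF⟩

end Enumeration

/-! ### Recovering the index map from the Markov graph and from the plane tree -/

section Trees

/-- The Markov graph of the arcs between consecutive indices under an index map `σ`. -/
def arrows (σ : ℤ → ℤ) (i j : ℤ) : Prop := σ (i + 1) ≤ j ∧ j < σ i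

/-- The end points of the interval of vertices at level `n + 1`. -/
def level (σ : ℤ → ℤ) : ℕ → ℤ × ℤ
  | 0 => (-1, 0)
  | n + 1 => (σ (level σ n).2, σ (level σ n).1)

variable {σ τ : ℤ → ℤ}

/-- The largest target of `i` is `σ i - 1`. -/
theorem eq_of_arrows_eq (hσ : StrictAnti σ) (hτ : StrictAnti τ) (h : arrows σ = arrows τ) :
    σ = τ := by
  have key : ∀ {σ τ : ℤ → ℤ}, StrictAnti σ → arrows σ = arrows τ → ∀ i, σ i ≤ τ i := by
    intro σ τ hσ h i
    have h1 : arrows σ i (σ i - 1) := ⟨by have := hσ (lt_add_one i); omega, by omega⟩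
    rw [h] at h1
    have := h1.2
    omega
  exact funext fun i => le_antisymm (key hσ h i) (key hτ h.symm i)

/-- Images of consecutive arcs abut, so the targets of an interval of vertices fill an interval.
This is what makes each level an interval. -/
theorem exists_arrow_iff (hσ : StrictAnti σ) {p q : ℤ} (hpq : p ≤ q) (j : ℤ) :
    (∃ i, (p ≤ i ∧ i < q) ∧ arrows σ i j) ↔ σ q ≤ j ∧ j < σ p := by
  induction q, hpq using Int.leInduction with
  | base =>
    constructor
    · rintro ⟨i, hi, -⟩; omega
    · rintro ⟨h1, h2⟩; omega
  | succ q hq ih =>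
    have h1 := hσ (lt_add_one q)
    have h2 := hσ.antitone hq
    constructor
    · rintro ⟨i, ⟨hi1, hi2⟩, hij⟩
      by_cases hiq : i = q
      · subst hiq
        exact ⟨hij.1, by have := hij.2; omega⟩
      · have := ih.1 ⟨i, ⟨hi1, by omega⟩, hij⟩
        omega
    · rintro ⟨h3, h4⟩
      by_cases hj : σ q ≤ j
      · obtain ⟨i, hi, hij⟩ := ih.2 ⟨hj, h4⟩
        exact ⟨i, by omega, hij⟩
      · exact ⟨q, by omega, h3, by omega⟩

theorem level_lt (hσ : StrictAnti σ) (n : ℕ) : (level σ n).1 < (level σ n).2 := by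
  induction n with
  | zero => simp [level]
  | succ n ih => exact hσ ih

theorem atLevel_iff (hσ : StrictAnti σ) (n : ℕ) (i : ℤ) :
    AtLevel (arrows σ) (n + 1) i ↔ (level σ n).1 ≤ i ∧ i < (level σ n).2 := by
  induction n generalizing i with
  | zero =>
    constructor
    · intro h
      cases h
      simp [level]
    · intro h
      simp only [level] at h
      obtain rfl : i = -1 := by omega
      exact AtLevel.one
  | succ n ih =>
    rw [level, ← exists_arrow_iff hσ (level_lt hσ n).le]
    constructor
    · intro h
      cases h with
      | step h1 h2 => exact ⟨_, (ih _).1 h1, h2⟩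
    · rintro ⟨j, hj, hji⟩
      exact AtLevel.step ((ih j).2 hj) hji

/-- Consecutive levels on each side of the vertex `0` are adjacent. -/
theorem level_adjacent (h0 : σ 0 = 1) (h1 : σ 1 = -1) (m : ℕ) :
    (level σ (2 * m + 2)).2 = (level σ (2 * m)).1 ∧
      (level σ (2 * m + 3)).1 = (level σ (2 * m + 1)).2 := by
  induction m with
  | zero => simp [level, h0, h1]
  | succ m ih =>
    have e2 : (level σ (2 * (m + 1) + 2)).2 = (level σ (2 * (m + 1))).1 := by
      change σ (level σ (2 * m + 3)).1 = σ (level σ (2 * m + 1)).2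
      rw [ih.2]
    refine ⟨e2, ?_⟩
    change σ (level σ (2 * (m + 1) + 2)).2 = σ (level σ (2 * (m + 1))).1
    rw [e2]

/-- Levels are nonempty and adjacent on each side, so they move outward by at least one each time;
hence they exhaust the nonzero integers. -/
theorem level_bounds (hσ : StrictAnti σ) (h0 : σ 0 = 1) (h1 : σ 1 = -1) (m : ℕ) :
    (level σ (2 * m)).2 ≤ -m ∧ (level σ (2 * m)).1 ≤ -(m + 1) ∧
      m + 1 ≤ (level σ (2 * m + 1)).1 ∧ m + 2 ≤ (level σ (2 * m + 1)).2 := by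
  induction m with
  | zero =>
    have := hσ (show (-1 : ℤ) < 0 by omega)
    simp [level, h0]; omega
  | succ m ih =>
    have h2 := level_adjacent h0 h1 m
    have h3 := level_lt hσ (2 * m + 2)
    have h4 := level_lt hσ (2 * m + 3)
    rw [show 2 * (m + 1) + 1 = 2 * m + 3 by ring, show 2 * (m + 1) = 2 * m + 2 by ring]
    push_cast
    omega

theorem exists_atLevel (hσ : StrictAnti σ) (h0 : σ 0 = 1) (h1 : σ 1 = -1) {i : ℤ} (hi : i ≠ 0) :
    ∃ n, AtLevel (arrows σ) (n + 1) i := by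
  simp only [atLevel_iff hσ]
  rcases hi.lt_or_gt with hi | hi
  · have key : ∀ m : ℕ, (level σ (2 * m)).1 ≤ i → ∃ n, (level σ n).1 ≤ i ∧ i < (level σ n).2 := by
      intro m
      induction m with
      | zero => exact fun h => ⟨0, h, hi⟩
      | succ m ih =>
        intro h
        by_cases h2 : (level σ (2 * m)).1 ≤ i
        · exact ih h2
        · refine ⟨2 * m + 2, h, ?_⟩
          rw [(level_adjacent h0 h1 m).1]; omega
    refine key i.natAbs ?_
    have := (level_bounds hσ h0 h1 i.natAbs).2.1
    omega
  · have key : ∀ m : ℕ, i < (level σ (2 * m + 1)).2 →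
        ∃ n, (level σ n).1 ≤ i ∧ i < (level σ n).2 := by
      intro m
      induction m with
      | zero =>
        refine fun h => ⟨1, ?_, h⟩
        simp only [level, h0]; omega
      | succ m ih =>
        intro h
        by_cases h2 : i < (level σ (2 * m + 1)).2
        · exact ih h2
        · refine ⟨2 * m + 3, ?_, h⟩
          rw [(level_adjacent h0 h1 m).2]; omega
    refine key i.natAbs ?_
    have := (level_bounds hσ h0 h1 i.natAbs).2.2.2
    omega

/-- Vertices to the left of 0 have targets at least `σ 0 = 1`, and vertices to the right have
targets below `σ 1 = -1`. -/
theorem arrows_self_iff (hσ : StrictAnti σ) (h0 : σ 0 = 1) (h1 : σ 1 = -1) (i : ℤ) :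
    arrows σ i i ↔ i = 0 := by
  constructor
  · rintro ⟨h2, h3⟩
    by_contra hi
    rcases lt_or_gt_of_ne hi with hi | hi
    · have := hσ.antitone (show i + 1 ≤ 0 by omega)
      omega
    · have := hσ.antitone (show 1 ≤ i by omega)
      omega
  · rintro rfl
    simp [arrows, h0, h1]

theorem AtLevel.map {A B : ℤ → ℤ → Prop} {φ : ℤ → ℤ} (h1 : ∀ i j, A i j → B (φ i) (φ j))
    (h2 : φ (-1) = -1) {n : ℕ} {i : ℤ} (h : AtLevel A (n + 1) i) : AtLevel B (n + 1) (φ i) := by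
  induction n generalizing i with
  | zero => cases h; rw [h2]; exact AtLevel.one
  | succ n ih =>
    cases h with
    | step h3 h4 => exact AtLevel.step (ih h3) (h1 _ _ h4)

/-- Vertex 0 is recognized by the only loop, and -1 as its only other target. -/
theorem map_zero_of_arrows {φ : ℤ → ℤ} (hφ : Function.Injective φ) (hσ : StrictAnti σ)
    (h0 : σ 0 = 1) (h1 : σ 1 = -1) (hτ : StrictAnti τ) (t0 : τ 0 = 1) (t1 : τ 1 = -1)
    (h : ∀ i j, arrows σ i j → arrows τ (φ i) (φ j)) : φ 0 = 0 ∧ φ (-1) = -1 := by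
  have e0 : φ 0 = 0 :=
    (arrows_self_iff hτ t0 t1 _).1 (h 0 0 ((arrows_self_iff hσ h0 h1 0).2 rfl))
  refine ⟨e0, ?_⟩
  have h2 := h 0 (-1) (by simp [arrows, h0, h1])
  rw [e0] at h2
  simp only [arrows, zero_add, t0, t1] at h2
  have h3 : φ (-1) ≠ 0 := fun e => by
    have := hφ (e.trans e0.symm)
    omega
  omega

theorem self_le_of_strictMonoOn {f : ℤ → ℤ} {m p q : ℤ}
    (hf : ∀ i j, m ≤ i → i < j → j < p → f i < f j)
    (hm : ∀ i, m ≤ i → i < p → m ≤ f i ∧ f i < q) (i : ℤ) (hi : m ≤ i) (hp : i < p) : i ≤ f i := by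
  induction i, hi using Int.leInduction with
  | base => exact (hm m le_rfl hp).1
  | succ i hi ih =>
    have := hf i (i + 1) hi (by omega) hp
    have := ih (by omega)
    omega

/-- An increasing map with an increasing left inverse between two intervals with the same left
end point is the identity. -/
theorem interval_rigid {f g : ℤ → ℤ} {m p q : ℤ} (hmp : m < p) (hmq : m < q)
    (hf : ∀ i j, m ≤ i → i < j → j < p → f i < f j) (hg : ∀ i j, m ≤ i → i < j → j < q → g i < g j)
    (hfm : ∀ i, m ≤ i → i < p → m ≤ f i ∧ f i < q) (hgm : ∀ i, m ≤ i → i < q → m ≤ g i ∧ g i < p)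
    (hgf : ∀ i, g (f i) = i) :
    p = q ∧ ∀ i, m ≤ i → i < p → f i = i := by
  have h1 := self_le_of_strictMonoOn hf hfm
  have h2 := self_le_of_strictMonoOn hg hgm
  refine ⟨?_, fun i hi hp => ?_⟩
  · have h3 := h1 (p - 1) (by omega) (by omega)
    have h4 := hfm (p - 1) (by omega) (by omega)
    have h5 := h2 (q - 1) (by omega) (by omega)
    have h6 := hgm (q - 1) (by omega) (by omega)
    omega
  · have h3 := h1 i hi hp
    have h4 := hfm i hi hp
    have h5 := h2 (f i) h4.1 h4.2
    rw [hgf] at h5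
    omega

/-- A plane isomorphism between two folding trees preserves the numbers of the vertices. -/
theorem plane_iso_eq_id (hσ : StrictAnti σ) (h0 : σ 0 = 1) (h1 : σ 1 = -1) (hτ : StrictAnti τ)
    (t0 : τ 0 = 1) (t1 : τ 1 = -1) (φ : ℤ ≃ ℤ) (hφ : ∀ i j, arrows σ i j ↔ arrows τ (φ i) (φ j))
    (hord : ∀ n i j, AtLevel (arrows σ) n i → AtLevel (arrows σ) n j →
      (|i| < |j| ↔ |φ i| < |φ j|)) (i : ℤ) : φ i = i := by
  obtain ⟨p0, p1⟩ := map_zero_of_arrows φ.injective hσ h0 h1 hτ t0 t1 fun i j => (hφ i j).1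
  have hφ' : ∀ i j, arrows τ i j ↔ arrows σ (φ.symm i) (φ.symm j) := fun i j => by
    rw [hφ]; simp
  have p1' : φ.symm (-1) = -1 := by rw [Equiv.symm_apply_eq, p1]
  have hup : ∀ n i, (level σ n).1 ≤ i ∧ i < (level σ n).2 →
      (level τ n).1 ≤ φ i ∧ φ i < (level τ n).2 := fun n i hi =>
    (atLevel_iff hτ n _).1 (AtLevel.map (fun i j => (hφ i j).1) p1 ((atLevel_iff hσ n i).2 hi))
  have hdn : ∀ n i, (level τ n).1 ≤ i ∧ i < (level τ n).2 →
      (level σ n).1 ≤ φ.symm i ∧ φ.symm i < (level σ n).2 := fun n i hi =>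
    (atLevel_iff hσ n _).1
      (AtLevel.map (fun i j => (hφ' i j).1) p1' ((atLevel_iff hτ n i).2 hi))
  have hordσ : ∀ n i j, ((level σ n).1 ≤ i ∧ i < (level σ n).2) →
      ((level σ n).1 ≤ j ∧ j < (level σ n).2) → (|i| < |j| ↔ |φ i| < |φ j|) := fun n i j hi hj =>
    hord (n + 1) i j ((atLevel_iff hσ n i).2 hi) ((atLevel_iff hσ n j).2 hj)
  have hordτ : ∀ n i j, ((level τ n).1 ≤ i ∧ i < (level τ n).2) →
      ((level τ n).1 ≤ j ∧ j < (level τ n).2) → (|i| < |j| ↔ |φ.symm i| < |φ.symm j|) := by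
    intro n i j hi hj
    rw [hordσ n _ _ (hdn n i hi) (hdn n j hj)]
    simp
  have even : ∀ m : ℕ, (level σ (2 * m)).2 = (level τ (2 * m)).2 →
      (level σ (2 * m)).1 = (level τ (2 * m)).1 ∧
      ∀ i, (level σ (2 * m)).1 ≤ i → i < (level σ (2 * m)).2 → φ i = i := by
    intro m he
    have b1 := level_bounds hσ h0 h1 m
    have b2 := level_lt hσ (2 * m)
    have b3 := level_lt hτ (2 * m)
    have u := hup (2 * m)
    have d := hdn (2 * m)
    have o := hordσ (2 * m)
    have o' := hordτ (2 * m)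
    rw [← he] at b3 u d o'
    generalize (level σ (2 * m)).1 = A at *
    generalize (level σ (2 * m)).2 = B at *
    generalize (level τ (2 * m)).1 = C at *
    -- Reflection turns the order by modulus on the negative side into the usual order, and the
    -- half-open `[A, B)` into `[-B + 1, -A + 1)`, whose left end is the known one.
    have := interval_rigid (f := fun i => -φ (-i)) (g := fun i => -φ.symm (-i)) (m := -B + 1)
      (p := -A + 1) (q := -C + 1) (by omega) (by omega)
      (fun i j hi hij hj => by
        have a1 := u (-i) (by omega)
        have a2 := u (-j) (by omega)
        have := (o (-i) (-j) (by omega) (by omega)).1 (by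
          rw [abs_neg, abs_neg, abs_of_nonneg, abs_of_nonneg] <;> omega)
        rw [abs_of_nonpos (by omega), abs_of_nonpos (by omega)] at this
        exact this)
      (fun i j hi hij hj => by
        have a1 := d (-i) (by omega)
        have a2 := d (-j) (by omega)
        have := (o' (-i) (-j) (by omega) (by omega)).1 (by
          rw [abs_neg, abs_neg, abs_of_nonneg, abs_of_nonneg] <;> omega)
        rw [abs_of_nonpos (by omega), abs_of_nonpos (by omega)] at this
        exact this)
      (fun i hi hp => by have := u (-i) (by omega); omega)
      (fun i hi hp => by have := d (-i) (by omega); omega)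
      (fun i => by simp)
    refine ⟨by omega, fun i hi hp => ?_⟩
    have e := this.2 (-i) (by omega) (by omega)
    simp only [neg_neg] at e
    omega
  have odd : ∀ m : ℕ, (level σ (2 * m + 1)).1 = (level τ (2 * m + 1)).1 →
      (level σ (2 * m + 1)).2 = (level τ (2 * m + 1)).2 ∧
      ∀ i, (level σ (2 * m + 1)).1 ≤ i → i < (level σ (2 * m + 1)).2 → φ i = i := by
    intro m he
    have b1 := level_bounds hσ h0 h1 m
    have b2 := level_lt hσ (2 * m + 1)
    have b3 := level_lt hτ (2 * m + 1)
    have u := hup (2 * m + 1)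
    have d := hdn (2 * m + 1)
    have o := hordσ (2 * m + 1)
    have o' := hordτ (2 * m + 1)
    rw [← he] at b3 u d o'
    generalize (level σ (2 * m + 1)).1 = A at *
    generalize (level σ (2 * m + 1)).2 = B at *
    generalize (level τ (2 * m + 1)).2 = C at *
    exact interval_rigid (f := φ) (g := φ.symm) b2 b3
      (fun i j hi hij hj => by
        have a1 := u i (by omega)
        have a2 := u j (by omega)
        have := (o i j (by omega) (by omega)).1 (by
          rw [abs_of_nonneg, abs_of_nonneg] <;> omega)
        rwa [abs_of_nonneg (by omega), abs_of_nonneg (by omega)] at this)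
      (fun i j hi hij hj => by
        have a1 := d i (by omega)
        have a2 := d j (by omega)
        have := (o' i j (by omega) (by omega)).1 (by
          rw [abs_of_nonneg, abs_of_nonneg] <;> omega)
        rwa [abs_of_nonneg (by omega), abs_of_nonneg (by omega)] at this)
      (fun i hi hp => u i ⟨hi, hp⟩) (fun i hi hp => d i ⟨hi, hp⟩) (by simp)
  -- The inner ends of the levels agree by induction: each is the outer end of the level two steps
  -- before.
  have hlev : ∀ m : ℕ, (level σ (2 * m)).2 = (level τ (2 * m)).2 ∧
      (level σ (2 * m + 1)).1 = (level τ (2 * m + 1)).1 := by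
    intro m
    induction m with
    | zero => simp [level, h0, t0]
    | succ m ih =>
      rw [show 2 * (m + 1) + 1 = 2 * m + 3 by ring, show 2 * (m + 1) = 2 * m + 2 by ring,
        (level_adjacent h0 h1 m).1, (level_adjacent t0 t1 m).1, (level_adjacent h0 h1 m).2,
        (level_adjacent t0 t1 m).2]
      exact ⟨(even m ih.1).1, (odd m ih.2).1⟩
  by_cases hi : i = 0
  · rw [hi, p0]
  · obtain ⟨n, hn⟩ := exists_atLevel hσ h0 h1 hi
    rw [atLevel_iff hσ] at hn
    obtain ⟨m, rfl | rfl⟩ := Nat.even_or_odd' n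
    · exact (even m (hlev m).1).2 i hn.1 hn.2
    · exact (odd m (hlev m).2).2 i hn.1 hn.2

theorem samePlaneTree_refl (A : ℤ → ℤ → Prop) : SamePlaneTree A A :=
  ⟨Equiv.refl ℤ, fun _ _ => Iff.rfl, fun _ _ _ _ _ => Iff.rfl⟩

theorem arrows_eq_of_samePlaneTree (hσ : StrictAnti σ) (h0 : σ 0 = 1) (h1 : σ 1 = -1)
    (hτ : StrictAnti τ) (t0 : τ 0 = 1) (t1 : τ 1 = -1)
    (h : SamePlaneTree (arrows σ) (arrows τ)) : arrows σ = arrows τ := by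
  obtain ⟨φ, hφ, hord⟩ := h
  have hid := plane_iso_eq_id hσ h0 h1 hτ t0 t1 φ hφ hord
  funext i j
  have := hφ i j
  rw [hid, hid] at this
  exact propext this

end Trees

/-! ### Essential itineraries of turning points as signs near gluing points -/

section Kneading

variable {a b a' b' : ℝ}

theorem isItinerary_param_iff (h : (a, b) ∈ S) {t : ℝ} {p : ℤ → ℤˣ} :
    IsItinerary a b (param a b t) p ↔ ∀ k, 0 ≤ ((p k : ℤ) : ℝ) * xc a b (eig a b ^ k * t) := by
  unfold IsItinerary
  simp only [iter_param h]
  rfl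

theorem eventually_units_pos_unique {l : Filter ℝ} [l.NeBot] {f : ℝ → ℝ} {q r : ℤˣ}
    (hq : ∀ᶠ s in l, 0 < ((q : ℤ) : ℝ) * f s) (hr : ∀ᶠ s in l, 0 < ((r : ℤ) : ℝ) * f s) :
    r = q := by
  obtain ⟨s, h1, h2⟩ := (hq.and hr).exists
  exact units_eq_of_mul_pos h1 h2.le

/-- An essential itinerary of the turning point given by a gluing point is determined by the signs
near that point, except for the free sign at the visit of the vertical axis. -/
theorem isEssItinerary_iff (h : (a, b) ∈ S) {g : ℝ} (hg : g ∈ glu a b) {p : ℤ → ℤˣ} :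
    IsEssItinerary a b (param a b (eig a b * g)) p ↔
      ∀ n : ℤ, n ≠ 0 → ∀ᶠ s in 𝓝[≠] g, 0 < ((p (n - 1) : ℤ) : ℝ) * xc a b (eig a b ^ n * s) := by
  have hshift : ∀ (n : ℤ) (s : ℝ), eig a b ^ (n - 1) * (eig a b * s) = eig a b ^ n * s := by
    intro n s
    rw [mul_left_comm, ← eig_zpow_succ h, sub_add_cancel]
  have hev : ∀ (n : ℤ) (q : ℤˣ), (∀ᶠ s in 𝓝[≠] (eig a b * g),
      0 < ((q : ℤ) : ℝ) * xc a b (eig a b ^ (n - 1) * s)) ↔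
      ∀ᶠ s in 𝓝[≠] g, 0 < ((q : ℤ) : ℝ) * xc a b (eig a b ^ n * s) := by
    intro n q
    have := eventually_scale h (n := 1) (t := g)
      (P := fun s => 0 < ((q : ℤ) : ℝ) * xc a b (eig a b ^ (n - 1) * s))
    simpa only [zpow_one, hshift] using this
  unfold IsEssItinerary
  rw [isItinerary_param_iff h]
  simp only [iter_param h]
  change (_ ∧ ∀ k l : ℤ, k < l → xc a b (eig a b ^ k * (eig a b * g)) = 0 →
    xc a b (eig a b ^ l * (eig a b * g)) = 0 → ∀ t, param a b t = param a b (eig a b * g) →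
    ∀ᶠ s in 𝓝[≠] t, 0 < ((p l : ℤ) : ℝ) * xc a b (eig a b ^ l * s)) ↔ _
  constructor
  · rintro ⟨h1, h2⟩ n hn
    by_cases hx : xc a b (eig a b ^ n * g) = 0
    · have hn0 : 0 < n := by
        by_contra hlt
        exact hg.2 n (by omega) hx
      rw [← hev]
      -- The earlier visit is at time -1 of the turning point, that is, at the gluing point.
      refine h2 (0 - 1) (n - 1) (by omega) ?_ ?_ _ rfl
      · rw [hshift, zpow_zero, one_mul]; exact hg.1
      · rw [hshift]; exact hx
    · have h3 := h1 (n - 1)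
      rw [hshift] at h3
      refine nhdsWithin_le_nhds (eventually_sign h (lt_of_le_of_ne h3 fun e => ?_))
      rcases mul_eq_zero.1 e.symm with e | e
      · rcases units_cast_cases (p (n - 1)) with e' | e' <;> rw [e'] at e <;> norm_num at e
      · exact hx e
  · intro h1
    refine ⟨fun k => ?_, fun k l hkl hk hl t ht => ?_⟩
    · obtain ⟨n, rfl⟩ : ∃ n, k = n - 1 := ⟨k + 1, by ring⟩
      rw [hshift]
      by_cases hn : n = 0
      · rw [hn, zpow_zero, one_mul, hg.1, mul_zero]
      · have hc : Continuous fun s => ((p (n - 1) : ℤ) : ℝ) * xc a b (eig a b ^ n * s) :=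
          continuous_const.mul ((continuous_xc h).comp (continuous_const_mul _))
        exact ge_of_tendsto ((hc.tendsto g).mono_left nhdsWithin_le_nhds)
          ((h1 n hn).mono fun s hs => hs.le)
    · obtain ⟨n, rfl⟩ : ∃ n, l = n - 1 := ⟨l + 1, by ring⟩
      obtain ⟨m, rfl⟩ : ∃ m, k = m - 1 := ⟨k + 1, by ring⟩
      rw [hshift] at hk
      rw [param_injective h ht, hev]
      refine h1 n ?_
      rintro rfl
      exact hg.2 m (by omega) hk

theorem exists_essItinerary (h : (a, b) ∈ S) {g : ℝ} (hg : g ∈ glu a b) :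
    ∃ p, IsEssItinerary a b (param a b (eig a b * g)) p := by
  have hex : ∀ n : ℤ, ∃ q : ℤˣ, n + 1 ≠ 0 →
      ∀ᶠ s in 𝓝[≠] g, 0 < ((q : ℤ) : ℝ) * xc a b (eig a b ^ (n + 1) * s) := by
    intro n
    rcases lt_trichotomy (n + 1) 0 with hn | hn | hn
    · obtain ⟨q, hq⟩ := exists_units_mul_pos (hg.2 _ hn)
      exact ⟨q, fun _ => nhdsWithin_le_nhds (eventually_sign h hq)⟩
    -- At the gluing point itself either sign is allowed.
    · exact ⟨1, fun h => absurd hn h⟩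
    · obtain ⟨q, hq⟩ := glu_image_sign h hg (show 1 ≤ n + 1 by omega)
      exact ⟨q, fun _ => hq⟩
  choose p hp using hex
  refine ⟨p, (isEssItinerary_iff h hg).2 fun n hn => ?_⟩
  have := hp (n - 1) (by omega)
  rwa [sub_add_cancel] at this

theorem mem_kneadingSet (h : (a, b) ∈ S) {p : ℤ → ℤˣ} :
    p ∈ kneadingSet a b ↔ ∃ g ∈ glu a b, IsEssItinerary a b (param a b (eig a b * g)) p := by
  constructor
  · rintro ⟨T, hT, hp⟩
    obtain ⟨g, hg, rfl⟩ := (mem_turningPts h).1 hT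
    exact ⟨g, hg, hp⟩
  · rintro ⟨g, hg, hp⟩
    exact ⟨_, (mem_turningPts h).2 ⟨g, hg, rfl⟩, hp⟩

end Kneading

/-! ### The index map determines the kneading set -/

section PatternToKneading

variable {a b a' b' : ℝ} {e e' : ℤ → ℝ} {σ : ℤ → ℤ}

namespace BasicEnum

theorem not_mem_bas_gap (H : BasicEnum a b e σ) {i : ℤ} {t : ℝ}
    (ht : t ∈ Set.Ioo (e i) (e (i + 1))) : t ∉ bas a b := by
  intro hb
  obtain ⟨j, rfl⟩ := H.exists_eq hb
  have h1 := H.strictMono.lt_iff_lt.1 ht.1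
  have h2 := H.strictMono.lt_iff_lt.1 ht.2
  omega

theorem exists_gap (h : (a, b) ∈ S) (H : BasicEnum a b e σ) {t : ℝ} (ht : t ∉ bas a b) :
    ∃ i, t ∈ Set.Ioo (e i) (e (i + 1)) := by
  obtain ⟨⟨u, hu, hu'⟩, v, hv, hv'⟩ := bas_unbounded h t
  obtain ⟨j, rfl⟩ := H.exists_eq hu
  obtain ⟨k, rfl⟩ := H.exists_eq hv
  obtain ⟨m, hm, hmax⟩ := Int.exists_greatest_of_bdd (P := fun m => e m < t)
    ⟨j, fun m hm => (H.strictMono.lt_iff_lt.1 (hm.trans hu')).le⟩ ⟨k, hv'⟩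
  refine ⟨m, hm, lt_of_le_of_ne (not_lt.1 fun hlt => ?_) fun e => ht (e ▸ H.mem_bas _)⟩
  have := hmax _ hlt
  omega

theorem eventually_gap_right (H : BasicEnum a b e σ) (i : ℤ) :
    ∀ᶠ s in 𝓝[>] (e i), s ∈ Set.Ioo (e i) (e (i + 1)) :=
  Ioo_mem_nhdsGT (H.strictMono (by omega))

theorem eventually_gap_left (H : BasicEnum a b e σ) (i : ℤ) :
    ∀ᶠ s in 𝓝[<] (e (i + 1)), s ∈ Set.Ioo (e i) (e (i + 1)) :=
  Ioo_mem_nhdsLT (H.strictMono (by omega))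

/-- The signs of the first coordinate on the basic arcs. -/
def IsGapSign (a b : ℝ) (e : ℤ → ℝ) (q : ℤ → ℤˣ) : Prop :=
  ∀ i, ∀ t ∈ Set.Ioo (e i) (e (i + 1)), 0 < ((q i : ℤ) : ℝ) * xc a b t

/-- A zero of the first coordinate is itself a basic parameter, so none lies inside a gap. -/
theorem exists_isGapSign (h : (a, b) ∈ S) (H : BasicEnum a b e σ) :
    ∃ q, IsGapSign a b e q := by
  have hne : ∀ i, ∀ t ∈ Set.Ioo (e i) (e (i + 1)), xc a b t ≠ 0 := fun i t ht hx =>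
    H.not_mem_bas_gap ht ⟨0, le_rfl, by simpa using hx⟩
  have hex : ∀ i, ∃ q : ℤˣ, ∀ t ∈ Set.Ioo (e i) (e (i + 1)), 0 < ((q : ℤ) : ℝ) * xc a b t := by
    intro i
    obtain ⟨u, hu1, hu2⟩ := exists_between (H.strictMono (lt_add_one i))
    obtain ⟨q, hq⟩ := exists_units_mul_pos (hne i u ⟨hu1, hu2⟩)
    refine ⟨q, fun t ht => ?_⟩
    by_contra hn
    have hc : Continuous fun s => ((q : ℤ) : ℝ) * xc a b s :=
      continuous_const.mul (continuous_xc h)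
    obtain ⟨z, hz, hz0⟩ := isPreconnected_Ioo.intermediate_value ht ⟨hu1, hu2⟩ hc.continuousOn
      ⟨not_lt.1 hn, hq.le⟩
    rcases mul_eq_zero.1 hz0 with e1 | e1
    · rcases units_cast_cases q with e' | e' <;> rw [e'] at e1 <;> norm_num at e1
    · exact hne i z hz e1
  choose q hq using hex
  exact ⟨q, hq⟩

theorem gapSign_zero (h : (a, b) ∈ S) (H : BasicEnum a b e σ) {q : ℤ → ℤˣ}
    (hq : IsGapSign a b e q) : q 0 = 1 := by
  have h0 : (0 : ℝ) ∈ Set.Ioo (e 0) (e (0 + 1)) := by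
    have e1 : e (0 + 1) = eig a b * e 0 := by rw [H.eig_mul, H.map_zero h, zero_add]
    rw [e1, H.zero]
    exact ⟨e0_neg h, mul_pos_of_neg_of_neg (by linarith [eig_lt h]) (e0_neg h)⟩
  have h1 := hq 0 0 h0
  have h2 : 0 < xc a b 0 := xc_pos_of_small h (by
    have := (S_bounds h).2.2.2
    rw [abs_zero]; positivity)
  exact (units_eq_of_mul_pos h1 (r := 1) (by simpa using h2.le)).symm

/-- The curve crosses the axis at a gluing point, whereas on both sides of any other basic point the
sign is the same because the curve folds there. -/
theorem gapSign_succ (h : (a, b) ∈ S) (H : BasicEnum a b e σ) {q : ℤ → ℤˣ}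
    (hq : IsGapSign a b e q) (i : ℤ) : q (i + 1) = q i ↔ i + 1 ∈ Set.range σ := by
  rw [← H.not_mem_glu h]
  have hr := (H.eventually_gap_right (i + 1)).mono fun s hs => hq (i + 1) s hs
  have hl := (H.eventually_gap_left i).mono fun s hs => hq i s hs
  constructor
  · intro heq hg
    obtain ⟨ε, hε, hcross⟩ := glu_cross h hg
    have h1 : ∀ᶠ s in 𝓝 (e (i + 1)), |s - e (i + 1)| < ε :=
      Metric.eventually_nhds_iff.2 ⟨ε, hε, fun _ hs => hs⟩
    obtain ⟨v, ⟨hv1, hv2⟩, hv3⟩ :=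
      ((hr.and (nhdsWithin_le_nhds h1)).and self_mem_nhdsWithin).exists
    obtain ⟨u, ⟨hu1, hu2⟩, hu3⟩ :=
      ((hl.and (nhdsWithin_le_nhds h1)).and self_mem_nhdsWithin).exists
    have h2 := hcross u v hu2 hv2 hu3 hv3
    rw [heq] at hv1
    rcases units_cast_cases (q i) with e1 | e1 <;> rw [e1] at hu1 hv1 <;> nlinarith
  · intro hg
    obtain ⟨r, hr'⟩ := sign_of_not_mem_glu h (H.mem_bas (i + 1)) hg
    have h1 : ∀ᶠ s in 𝓝[>] (e (i + 1)), 0 < ((r : ℤ) : ℝ) * xc a b s :=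
      nhdsWithin_mono _ (fun s hs => (ne_of_gt hs : s ≠ _)) hr'
    have h2 : ∀ᶠ s in 𝓝[<] (e (i + 1)), 0 < ((r : ℤ) : ℝ) * xc a b s :=
      nhdsWithin_mono _ (fun s hs => (ne_of_lt hs : s ≠ _)) hr'
    rw [← eventually_units_pos_unique hr h1, ← eventually_units_pos_unique hl h2]

theorem gapSign_eq (h : (a, b) ∈ S) (H : BasicEnum a b e σ) (h' : (a', b') ∈ S)
    (H' : BasicEnum a' b' e' σ) {q q' : ℤ → ℤˣ} (hq : IsGapSign a b e q)
    (hq' : IsGapSign a' b' e' q') : q = q' := by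
  have key : ∀ i, q i = q' i ↔ q (i + 1) = q' (i + 1) := by
    intro i
    have := (H.gapSign_succ h hq i).trans (H'.gapSign_succ h' hq' i).symm
    rcases Int.units_eq_one_or (q i) with e1 | e1 <;>
      rcases Int.units_eq_one_or (q' i) with e2 | e2 <;>
      rcases Int.units_eq_one_or (q (i + 1)) with e3 | e3 <;>
      rcases Int.units_eq_one_or (q' (i + 1)) with e4 | e4 <;>
      simp [e1, e2, e3, e4] at this ⊢
  funext i
  induction i using Int.induction_on with
  | zero => rw [H.gapSign_zero h hq, H'.gapSign_zero h' hq']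
  | succ i ih => exact (key i).1 ih
  | pred i ih => exact (key _).2 (by rwa [sub_add_cancel])

theorem zpow_mul (h : (a, b) ∈ S) (H : BasicEnum a b e σ) {n : ℤ} (hn : 0 ≤ n) (i : ℤ) :
    eig a b ^ n * e i = e (σ^[n.toNat] i) := by
  induction n, hn using Int.leInduction with
  | base => simp
  | succ n hn ih =>
    rw [eig_zpow_succ h, ih, H.eig_mul, Int.toNat_add hn one_pos.le]
    congr 1
    exact (Function.iterate_succ_apply' σ n.toNat i).symm

/-- Multiplying by an even power of the eigenvalue preserves order and makes both exponents
nonnegative. Thus `σ` alone orders even past images that are not basic points. -/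
theorem zpow_mul_lt_iff (h : (a, b) ∈ S) (H : BasicEnum a b e σ) (m n i j : ℤ) :
    eig a b ^ m * e i < eig a b ^ n * e j ↔
      σ^[(2 * (|m| + |n|) + m).toNat] i < σ^[(2 * (|m| + |n|) + n).toNat] j := by
  have hm := neg_abs_le m
  have hn := neg_abs_le n
  have hm' := abs_nonneg m
  have hn' := abs_nonneg n
  rw [← H.strictMono.lt_iff_lt, ← H.zpow_mul h (by omega), ← H.zpow_mul h (by omega),
    ← zpow_mul_zpow_mul h, ← zpow_mul_zpow_mul h]
  have hpos : 0 < eig a b ^ (2 * (|m| + |n|)) := by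
    rw [_root_.zpow_mul]
    exact zpow_pos (by have := eig_ne h; positivity) _
  exact (mul_lt_mul_iff_right₀ hpos).symm

/-- Past images of a gluing point lie inside gaps that the order identifies for both maps. Future
images are basic points, where the nearby signs are those of the two adjacent gaps. -/
theorem kneadingSet_subset (h : (a, b) ∈ S) (H : BasicEnum a b e σ) (h' : (a', b') ∈ S)
    (H' : BasicEnum a' b' e' σ) : kneadingSet a b ⊆ kneadingSet a' b' := by
  intro p hp
  obtain ⟨g, hg, hp⟩ := (mem_kneadingSet h).1 hp
  obtain ⟨i, rfl⟩ := H.exists_eq (glu_subset_bas hg)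
  have hg' : e' i ∈ glu a' b' := by
    by_contra hn
    rw [H'.not_mem_glu h', ← H.not_mem_glu h] at hn
    exact hn hg
  refine (mem_kneadingSet h').2 ⟨_, hg', ?_⟩
  rw [isEssItinerary_iff h hg] at hp
  rw [isEssItinerary_iff h' hg']
  obtain ⟨q, hq⟩ := H.exists_isGapSign h
  obtain ⟨q', hq'⟩ := H'.exists_isGapSign h'
  obtain rfl := H.gapSign_eq h h' H' hq hq'
  intro n hn
  have hpn := hp n hn
  rcases hn.lt_or_gt with hn | hn
  · have hnb : eig a b ^ n * e i ∉ bas a b := by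
      rintro ⟨k, hk, hx⟩
      rw [zpow_mul_zpow_mul h] at hx
      exact hg.2 _ (by omega) hx
    obtain ⟨k, hk⟩ := H.exists_gap h hnb
    have hqk := hq k _ hk
    have e1 : p (n - 1) = q k := by
      have := eventually_units_pos_unique (nhdsWithin_le_nhds (eventually_sign h hqk)) hpn
      exact this
    have t1 : eig a b ^ (0 : ℤ) * e k < eig a b ^ n * e i := by simpa using hk.1
    have t2 : eig a b ^ n * e i < eig a b ^ (0 : ℤ) * e (k + 1) := by simpa using hk.2
    rw [H.zpow_mul_lt_iff h, ← H'.zpow_mul_lt_iff h'] at t1 t2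
    rw [zpow_zero, one_mul] at t1 t2
    rw [e1]
    exact nhdsWithin_le_nhds (eventually_sign h' (hq' k _ ⟨t1, t2⟩))
  · rw [← eventually_scale h (P := fun s => 0 < ((p (n - 1) : ℤ) : ℝ) * xc a b s),
      H.zpow_mul h hn.le] at hpn
    rw [← eventually_scale h' (P := fun s => 0 < ((p (n - 1) : ℤ) : ℝ) * xc a' b' s),
      H'.zpow_mul h' hn.le]
    obtain ⟨j, hj⟩ : ∃ j, σ^[n.toNat] i = j + 1 := ⟨σ^[n.toNat] i - 1, by ring⟩
    rw [hj] at hpn ⊢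
    have h1 : ∀ᶠ s in 𝓝[>] (e (j + 1)), 0 < ((p (n - 1) : ℤ) : ℝ) * xc a b s :=
      nhdsWithin_mono _ (fun s hs => (ne_of_gt hs : s ≠ _)) hpn
    have h2 : ∀ᶠ s in 𝓝[<] (e (j + 1)), 0 < ((p (n - 1) : ℤ) : ℝ) * xc a b s :=
      nhdsWithin_mono _ (fun s hs => (ne_of_lt hs : s ≠ _)) hpn
    have e1 := eventually_units_pos_unique
      ((H.eventually_gap_right (j + 1)).mono fun s hs => hq (j + 1) s hs) h1
    have e2 := eventually_units_pos_unique
      ((H.eventually_gap_left j).mono fun s hs => hq j s hs) h2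
    rw [← Set.Iio_union_Ioi, nhdsWithin_union, eventually_sup]
    constructor
    · rw [e2]
      exact (H'.eventually_gap_left j).mono fun s hs => hq' j s hs
    · rw [e1]
      exact (H'.eventually_gap_right (j + 1)).mono fun s hs => hq' (j + 1) s hs

end BasicEnum

end PatternToKneading

/-! ### The kneading set determines the range of the index map -/

section KneadingToPattern

variable {a b a' b' : ℝ}

/-- The basic points with parameters `t` and `t'` of two Lozi maps are the same image of gluing
points whose turning points share an essential itinerary. -/
def Corresponds (a b a' b' t t' : ℝ) : Prop :=
  ∃ g ∈ glu a b, ∃ g' ∈ glu a' b', ∃ n : ℤ, 0 ≤ n ∧ ∃ p,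
    IsEssItinerary a b (param a b (eig a b * g)) p ∧
    IsEssItinerary a' b' (param a' b' (eig a' b' * g')) p ∧
    t = eig a b ^ n * g ∧ t' = eig a' b' ^ n * g'

namespace Corresponds

theorem symm {t t' : ℝ} : Corresponds a b a' b' t t' → Corresponds a' b' a b t' t := by
  rintro ⟨g, hg, g', hg', n, hn, p, h1, h2, h3, h4⟩
  exact ⟨g', hg', g, hg, n, hn, p, h2, h1, h4, h3⟩

theorem mem_left (h : (a, b) ∈ S) {t t' : ℝ} : Corresponds a b a' b' t t' → t ∈ bas a b := by
  rintro ⟨g, hg, g', hg', n, hn, p, h1, h2, rfl, h4⟩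
  exact zpow_mul_mem_bas h (glu_subset_bas hg) hn

theorem mem_glu (h : (a, b) ∈ S) {t t' : ℝ}
    (hc : Corresponds a b a' b' t t') (ht : t ∈ glu a b) : t' ∈ glu a' b' := by
  obtain ⟨g, hg, g', hg', n, hn, p, h1, h2, rfl, rfl⟩ := hc
  obtain ⟨rfl, -⟩ := glu_unique h hg ht (m := n) (n := 0) (by simp)
  simpa using hg'

theorem exists_right (h : (a, b) ∈ S) (h' : (a', b') ∈ S)
    (hK : kneadingSet a b = kneadingSet a' b') {t : ℝ} (ht : t ∈ bas a b) : ∃ t', Corresponds a b a' b' t t' := by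
  obtain ⟨g, hg, n, hn, rfl⟩ := exists_glu_of_mem_bas h ht
  obtain ⟨p, hp⟩ := exists_essItinerary h hg
  have : p ∈ kneadingSet a' b' := hK ▸ (mem_kneadingSet h).2 ⟨g, hg, hp⟩
  obtain ⟨g', hg', hp'⟩ := (mem_kneadingSet h').1 this
  exact ⟨_, g, hg, g', hg', n, hn, p, hp, hp', rfl, rfl⟩

theorem left_unique (h : (a, b) ∈ S) (h' : (a', b') ∈ S) {t₁ t₂ t' : ℝ}
    (h1 : Corresponds a b a' b' t₁ t') (h2 : Corresponds a b a' b' t₂ t') : t₁ = t₂ := by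
  obtain ⟨g₁, hg₁, g', hg', n, hn, p, hp, hp', rfl, rfl⟩ := h1
  obtain ⟨g₂, hg₂, g'', hg'', m, hm, q, hq, hq', rfl, e⟩ := h2
  obtain ⟨rfl, rfl⟩ := glu_unique h' hg' hg'' e
  -- Two essential itineraries of one turning point differ at most at time -1, where the sign is
  -- free, so `q` serves `g₁` as well.
  have hpq : IsEssItinerary a b (param a b (eig a b * g₁)) q := by
    rw [isEssItinerary_iff h hg₁] at hp ⊢
    rw [isEssItinerary_iff h' hg'] at hp' hq'
    intro k hk
    rw [eventually_units_pos_unique (hp' k hk) (hq' k hk)]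
    exact hp k hk
  have := eq_of_itinerary h q hpq.1 hq.1
  rw [mul_left_cancel₀ (eig_ne h) this]

theorem exists_itinerary (h : (a, b) ∈ S) (h' : (a', b') ∈ S) {t t' : ℝ}
    (hc : Corresponds a b a' b' t t') :
    ∃ p, IsItinerary a b (param a b t) p ∧ IsItinerary a' b' (param a' b' t') p := by
  obtain ⟨g, hg, g', hg', n, hn, p, hp, hp', rfl, rfl⟩ := hc
  have key : ∀ {a b g : ℝ}, (a, b) ∈ S → IsItinerary a b (param a b (eig a b * g)) p →
      -- The itinerary starts at the turning point `eig a b * g`, which explains the shift by `n -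
      -- 1`.
      IsItinerary a b (param a b (eig a b ^ n * g)) fun k => p (k + n - 1) := by
    intro a b g h hp
    rw [isItinerary_param_iff h] at hp ⊢
    intro k
    have := hp (k + n - 1)
    rw [mul_left_comm, ← eig_zpow_succ h, sub_add_cancel] at this
    rwa [zpow_mul_zpow_mul h]
  exact ⟨_, key h hp.1, key h' hp'.1⟩

theorem lt_iff (h : (a, b) ∈ S) (h' : (a', b') ∈ S) {s t s' t' : ℝ}
    (hs : Corresponds a b a' b' s s') (ht : Corresponds a b a' b' t t') : s < t ↔ s' < t' := by
  by_cases hst : s = t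
  · subst hst
    rw [left_unique h' h hs.symm ht.symm]
    simp
  · have hst' : s' ≠ t' := by
      rintro rfl
      exact hst (left_unique h h' hs ht)
    obtain ⟨p, hp, hp'⟩ := hs.exists_itinerary h h'
    obtain ⟨q, hq, hq'⟩ := ht.exists_itinerary h h'
    exact same_order h h' hst hst' hp hq hp' hq'

/-- The fixed point `X`, with parameter 0 and constant itinerary `1`, enters the comparison of
orders like any other point. -/
theorem neg_iff (h : (a, b) ∈ S) (h' : (a', b') ∈ S) {t t' : ℝ}
    (hc : Corresponds a b a' b' t t') : t < 0 ↔ t' < 0 := by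
  have hpos : ∀ {a b : ℝ}, (a, b) ∈ S → 0 < xc a b 0 := fun h => xc_pos_of_small h (by
    have := (S_bounds h).2.2.2
    rw [abs_zero]; positivity)
  have hne : ∀ {a b t : ℝ}, (a, b) ∈ S → t ∈ bas a b → t ≠ 0 := by
    rintro a b t h ⟨k, hk, hx⟩ rfl
    rw [mul_zero] at hx
    exact (hpos h).ne' hx
  have hit : ∀ {a b : ℝ}, (a, b) ∈ S → IsItinerary a b (param a b 0) fun _ => 1 := by
    intro a b h
    rw [isItinerary_param_iff h]
    intro k
    simpa using (hpos h).le
  obtain ⟨p, hp, hp'⟩ := hc.exists_itinerary h h'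
  exact same_order h h' (hne h (hc.mem_left h)) (hne h' (hc.symm.mem_left h')) hp (hit h) hp'
    (hit h')

end Corresponds

theorem BasicEnum.range_eq_of_kneadingSet_eq {e e' : ℤ → ℝ} {σ σ' : ℤ → ℤ} (h : (a, b) ∈ S)
    (H : BasicEnum a b e σ) (h' : (a', b') ∈ S) (H' : BasicEnum a' b' e' σ')
    (hK : kneadingSet a b = kneadingSet a' b') : Set.range σ = Set.range σ' := by
  have hex : ∀ i, ∃ t', Corresponds a b a' b' (e i) t' := fun i =>
    Corresponds.exists_right h h' hK (H.mem_bas i)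
  choose f hf using hex
  have hmono : StrictMono f := fun i j hij => ((hf i).lt_iff h h' (hf j)).1 (H.strictMono hij)
  have hrange : Set.range f = Set.range e' := by
    rw [H'.range_eq]
    ext t'
    constructor
    · rintro ⟨i, rfl⟩
      exact (hf i).symm.mem_left h'
    · intro ht'
      obtain ⟨t, ht⟩ := Corresponds.exists_right h' h hK.symm ht'
      obtain ⟨i, rfl⟩ := H.exists_eq (ht.symm.mem_left h)
      exact ⟨i, Corresponds.left_unique h' h (hf i).symm ht⟩
  have hlast : ∀ {a b : ℝ} {e : ℤ → ℝ} {σ : ℤ → ℤ}, (a, b) ∈ S → BasicEnum a b e σ → ∀ i,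
      e i < 0 ↔ i ≤ 0 := by
    intro a b e σ h H i
    constructor
    · intro hi
      by_contra hlt
      have h1 : e 1 ≤ e i := H.strictMono.monotone (by omega)
      rw [← H.map_zero h, ← H.eig_mul, H.zero] at h1
      have := mul_pos_of_neg_of_neg (show eig a b < 0 by linarith [eig_lt h]) (e0_neg h)
      linarith
    · intro hi
      have := H.strictMono.monotone hi
      rw [H.zero] at this
      linarith [e0_neg h]
  -- Index 0 belongs to the last basic point before `X`, a description that the correspondence
  -- preserves.
  have hzero : f 0 = e' 0 := by
    obtain ⟨j, hj⟩ : f 0 ∈ Set.range e' := hrange ▸ Set.mem_range_self 0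
    obtain ⟨k, hk⟩ : e' 0 ∈ Set.range f := hrange.symm ▸ Set.mem_range_self 0
    have h1 : f 0 < 0 := ((hf 0).neg_iff h h').1 ((hlast h H 0).2 le_rfl)
    have h2 : f k < 0 := hk ▸ (hlast h' H' 0).2 le_rfl
    rw [← hj, hlast h' H'] at h1
    rw [← (hf k).neg_iff h h', hlast h H] at h2
    have h3 : f k ≤ f 0 := hmono.monotone h2
    have h4 : e' j ≤ e' 0 := H'.strictMono.monotone h1
    linarith
  obtain rfl := strictMono_eq_of_range_eq hmono H'.strictMono hrange hzero
  ext i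
  rw [← H.not_mem_glu h, ← H'.not_mem_glu h', not_iff_not]
  exact ⟨(hf i).mem_glu h, (hf i).symm.mem_glu h'⟩

end KneadingToPattern

/-! ### All invariants in terms of the index map -/

section Main

variable {a b a' b' : ℝ} {e e' : ℤ → ℝ} {σ σ' : ℤ → ℤ}

theorem BasicEnum.map_eq_of_range_eq (h : (a, b) ∈ S) (H : BasicEnum a b e σ) (h' : (a', b') ∈ S)
    (H' : BasicEnum a' b' e' σ') (hr : Set.range σ = Set.range σ') : σ = σ' :=
  strictAnti_eq_of_range_eq (H.strictAnti h) (H'.strictAnti h') hr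
    (by rw [H.map_zero h, H'.map_zero h'])

theorem BasicEnum.foldingTree_eq_arrows (h : (a, b) ∈ S) (H : BasicEnum a b e σ) :
    foldingTree a b = arrows σ :=
  funext fun i => funext fun j => propext (H.foldingTree_iff h i j)

theorem BasicEnum.foldingPattern_eq_iff (h : (a, b) ∈ S) (H : BasicEnum a b e σ)
    (h' : (a', b') ∈ S) (H' : BasicEnum a' b' e' σ') :
    foldingPattern a b = foldingPattern a' b' ↔ Set.range σ = Set.range σ' := by
  constructor
  · intro heq
    ext i
    rw [← H.foldingPattern_eq h, ← H'.foldingPattern_eq h', heq]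
  · intro hr
    funext i
    have := (H.foldingPattern_eq h i).trans (hr ▸ (H'.foldingPattern_eq h' i).symm)
    cases h1 : foldingPattern a b i <;> cases h2 : foldingPattern a' b' i <;>
      simp [h1, h2] at this ⊢

end Main
end Lozi

theorem mainTheorem4 :
    (∀ a b : ℝ, (a, b) ∈ Lozi.S → ∃! E : ℤ → ℝ × ℝ, Lozi.IsBasicEnum a b E) ∧
    ∀ a b a' b' : ℝ, (a, b) ∈ Lozi.S → (a', b') ∈ Lozi.S →
      List.TFAE [
        Lozi.kneadingSet a b = Lozi.kneadingSet a' b',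
        Lozi.foldingPattern a b = Lozi.foldingPattern a' b',
        Lozi.foldingTree a b = Lozi.foldingTree a' b',
        Lozi.SamePlaneTree (Lozi.foldingTree a b) (Lozi.foldingTree a' b')] := by
  refine ⟨fun a b h => Lozi.existsUnique_isBasicEnum h, fun a b a' b' h h' => ?_⟩
  obtain ⟨e, σ, H⟩ := Lozi.exists_basicEnum h
  obtain ⟨e', σ', H'⟩ := Lozi.exists_basicEnum h'
  rw [H.foldingPattern_eq_iff h h' H', H.foldingTree_eq_arrows h, H'.foldingTree_eq_arrows h']
  tfae_have 1 → 2 := H.range_eq_of_kneadingSet_eq h h' H'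
  tfae_have 2 → 3 := fun hr => by rw [H.map_eq_of_range_eq h h' H' hr]
  tfae_have 3 → 1 := fun ht => by
    obtain rfl := Lozi.eq_of_arrows_eq (H.strictAnti h) (H'.strictAnti h') ht
    -- Both maps now have the same `σ`, and the inclusion of kneading sets is symmetric in them.
    exact Set.Subset.antisymm (H.kneadingSet_subset h h' H') (H'.kneadingSet_subset h' h H)
  tfae_have 3 → 4 := fun ht => ht ▸ Lozi.samePlaneTree_refl _
  tfae_have 4 → 3 := Lozi.arrows_eq_of_samePlaneTree (H.strictAnti h) (H.map_zero h)
    (H.map_one h) (H'.strictAnti h') (H'.map_zero h') (H'.map_one h')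
  tfae_finish
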